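/- **Setting.** Let $m\ge 0$, $n\ge 3t+1$, $\epsilon>0$, and let $\mathsf{ex\_val}:\mathbb R^m\to\{true,false\}$ be an external validity function, $V=\{v\in\mathbb R^m:\mathsf{ex\_val}(v)=true\}$. There are $n$ asynchronous nodes, at most $t$ of which are Byzantine (faulty) and behave arbitrarily; node $i$ has an input $v_i^0\in\mathbb R^m$. Nodes communicate by broadcast channels in which a message is tagged by its type and round number: (Validity) a nonfaulty node receives a broadcast from a nonfaulty node if and only if that node sent it; (Liveness) if one nonfaulty node receives a broadcast, then every nonfaulty node eventually does; (Uniqueness) broadcasts received from the same node with the same tag are equal, and each is received at most once by each node. "Eventually" is the only timing assumption; a nonfaulty node that has not terminated keeps taking steps. For finite multisets of points, $\mathrm{diam}(A)$ is the largest Euclidean distance of two members, $\mathrm{vote}(A)=\frac1{|A|}\sum_{v\in A}v$, and $\mathrm{Elim}_t(A)$ is obtained from $A$ by removing $t$ times in a row a maximal distance pair (with any fixed deterministic tie-breaking rule). Multisets are compared with multiplicity. **Protocol (code of a node).** All multisets $vals^s$, $reports^s$ ($s\ge0$), $times$ and the collections of waiting messages start empty, $r=0$, $halt=\infty$. In the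 background, until it terminates, the node reacts to received messages: on $(\text{init\_value},v)$ with $\mathsf{ex\_val}(v)=true$ it adds $v$ to $vals^0$, and if now $|vals^0|=n-t$ it broadcasts $(\text{report},vals^0,0)$; on $(\text{enough},e)$ with $e\in[-\infty,\infty]$ it adds $e$ to $times$, and if now $|times|\ge n-t$ it sets $halt$ to the $(t+1)$-th smallest member of $times$; value and report messages are stored as waiting. A report $(\text{report},A,s)$ is *ready* if $s\le r$, $|A|\ge n-t$, $A\subseteq vals^s$. A value message $(\text{value},v,A,R,s)$ is *ready* if $s\le r$, $|A|\ge n-t$, $|R|\ge n-t$, every $B\in R$ satisfies $B\subseteq A$, $A\subseteq vals^{s-1}$, $R\subseteq reports^{s-1}$, and either $s=1$ and $v\in\mathrm{conv}(\mathrm{Elim}_t(A))$, or $s>1$ and $v=\mathrm{vote}(A)$. *Initialization.* The node broadcasts $(\text{init\_value},v^0)$. While $|times|<n-t$ or $|reports^0|<n-t$, it takes the waiting ready reports $(\text{report},A,0)$ one after the other, adds $A$ to $reports^0$, and if now $|reports^0|=n-t$ it computes $v^1=\mathrm{vote}(\mathrm{Elim}_t(vals^0))$, keeps a copy $A^0,R^0$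 of $vals^0,reports^0$, and broadcasts $(\text{enough},\lceil\log_2(3\,\mathrm{diam}(vals^0)/\epsilon)\rceil+1)$, where $\log_2 0=-\infty$. Then it sets $r=1$ and broadcasts $(\text{value},v^1,A^0,R^0,1)$. *Main loop.* While $r<halt$: first it takes the waiting ready value messages $(\text{value},v,A,R,s)$ one after the other, adds $v$ to $vals^s$, and if $s=r$ and now $|vals^r|=n-t$ it broadcasts $(\text{report},vals^r,r)$; then it takes the waiting ready reports $(\text{report},A,s)$ one after the other, adds $A$ to $reports^s$, and if $s=r$ and now $|reports^r|=n-t$ it sets $r\leftarrow r+1$, $v^r=\mathrm{vote}(vals^{r-1})$ and broadcasts $(\text{value},v^r,vals^{r-1},reports^{r-1},r)$. When it finds $r\ge halt$ at the loop test, it outputs $v^r$ and terminates. (A message that is taken no longer waits.) **Theorem (round complexity).** In every execution: 1. if the inputs of all nonfaulty nodes are in $V$, then every nonfaulty node terminates; 2. if $V$ is bounded, then the round variable $r$ of every nonfaulty node never exceeds $$\max\Bigl\{1,\ \Bigl\lceil\log_2\frac{3\,\mathrm{diam}(V)}{\epsilon}\Bigr\rceil+1\Bigr\}$$ (read as $1$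 if $\mathrm{diam}(V)=0$). In particular it is $O(\log(\mathrm{diam}(V)/\epsilon))$: if $\mathrm{diam}(V)\ge2\epsilon$, then $r\le 5\log_2(\mathrm{diam}(V)/\epsilon)$. The round bound 2 needs neither the liveness assumptions nor valid inputs. -/

import Mathlib

noncomputable section

namespace ApproxAgreement

/-- Points of `ℝ^m` with the Euclidean distance. -/
abbrev Point (m : ℕ) : Type := EuclideanSpace ℝ (Fin m)

/-- Diameter of a finite multiset of points. -/
def mdiam {m : ℕ} (A : Multiset (Point m)) : ℝ := Metric.diam {x | x ∈ A}

/-- `f` is a deterministic rule that selects a maximal distance pair (two members, counted with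
multiplicity) of every multiset with at least two members. Ties may be broken in any way. -/
def IsFurthestRule {m : ℕ} (f : Multiset (Point m) → Point m × Point m) : Prop :=
  ∀ A : Multiset (Point m), 2 ≤ A.card →
    ({(f A).1, (f A).2} : Multiset (Point m)) ≤ A ∧
      ∀ x ∈ A, ∀ y ∈ A, dist x y ≤ dist (f A).1 (f A).2

open scoped Classical in
/-- Remove a maximal distance pair, `t` times in a row. -/
def elim {m : ℕ} (f : Multiset (Point m) → Point m × Point m) :
    ℕ → Multiset (Point m) → Multiset (Point m)
  | 0, A => A
  | t + 1, A => elim f t (A - {(f A).1, (f A).2})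

/-- The average of a multiset of points. -/
def vote {m : ℕ} (A : Multiset (Point m)) : Point m := (A.card : ℝ)⁻¹ • A.sum

/-- The number of rounds estimated from the round `0` values `A`:
`⌈log₂ (3 diam A / ε)⌉ + 1`, with the convention `log₂ 0 = -∞`. -/
def enoughRounds {m : ℕ} (ε : ℝ) (A : Multiset (Point m)) : EReal :=
  if mdiam A = 0 then ⊥
  else (((⌈Real.logb 2 (3 * mdiam A / ε)⌉ + 1 : ℤ) : ℝ) : EReal)

/-- The `(t+1)`-th smallest member of a multiset (`∞` if there are at most `t` members). -/
def nextSmallest (t : ℕ) (T : Multiset EReal) : EReal := (T.sort (· ≤ ·)).getD t ⊤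

/-! ### Messages -/

/-- A message `("value", v^s, rec_vals^(s-1), rec_reps^(s-1), s)`. -/
structure ValueMsg (m : ℕ) where
  point : Point m
  recVals : Multiset (Point m)
  recReps : Multiset (Multiset (Point m))
  round : ℕ

/-- A message `("report", rec_vals^s, s)`. -/
structure ReportMsg (m : ℕ) where
  recVals : Multiset (Point m)
  round : ℕ

inductive Msg (m : ℕ) where
  | initValue (v : Point m)
  | enough (e : EReal)
  | value (M : ValueMsg m)
  | report (M : ReportMsg m)

inductive MsgKind where
  | initValue
  | enough
  | value
  | report

/-- The tag of a broadcast: its type and its round number. -/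
def Msg.tag {m : ℕ} : Msg m → MsgKind × ℕ
  | .initValue _ => (.initValue, 0)
  | .enough _ => (.enough, 0)
  | .value M => (.value, M.round)
  | .report M => (.report, M.round)

/-! ### The code of one node -/

/-- The data that all nodes know: the number `n` of nodes, the bound `t` on the number of faulty
nodes, the precision, the external validity function, the rule for maximal distance pairs. -/
structure Setup (m : ℕ) where
  n : ℕ
  t : ℕ
  ε : ℝ
  exVal : Point m → Bool
  furthest : Multiset (Point m) → Point m × Point m

/-- The set of externally valid inputs. -/
def Setup.validInputs {m : ℕ} (S : Setup m) : Set (Point m) := {v | S.exVal v = true}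

/-- The position of the main thread of a node in its code. -/
inductive Phase where
  /-- before the broadcast of the input -/
  | start
  /-- at the test of the while loop of the initialization -/
  | initHead
  /-- in the for loop over the waiting round `0` reports of the initialization -/
  | initLoop
  /-- at the test of the main while loop -/
  | mainHead
  /-- in the for loop over the waiting value messages -/
  | valueLoop
  /-- in the for loop over the waiting report messages -/
  | reportLoop
  /-- the node has output its current vote and terminated -/
  | terminated

/-- The local variables of a node. `vote` is the current `v^r`; `voteVals` and `voteReps` are the
values and the reports held when it was computed; `sent` lists the broadcasts made so far. -/
structure NodeState (m : ℕ) where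
  phase : Phase
  r : ℕ
  terminationTimes : Multiset EReal
  waitingValues : Multiset (ValueMsg m)
  waitingReports : Multiset (ReportMsg m)
  values : ℕ → Multiset (Point m)
  reports : ℕ → Multiset (Multiset (Point m))
  halt : EReal
  vote : Point m
  voteVals : Multiset (Point m)
  voteReps : Multiset (Multiset (Point m))
  sent : List (Msg m)

/-- The initial state of a node with input `v`. -/
def NodeState.initial {m : ℕ} (v : Point m) : NodeState m where
  phase := .start
  r := 0
  terminationTimes := 0
  waitingValues := 0
  waitingReports := 0
  values := fun _ => 0
  reports := fun _ => 0
  halt := ⊤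
  vote := v
  voteVals := 0
  voteReps := 0
  sent := []

def NodeState.broadcast {m : ℕ} (x : NodeState m) (M : Msg m) : NodeState m :=
  { x with sent := M :: x.sent }

def NodeState.goto {m : ℕ} (x : NodeState m) (p : Phase) : NodeState m :=
  { x with phase := p }

def NodeState.addToValues {m : ℕ} (x : NodeState m) (s : ℕ) (v : Point m) : NodeState m :=
  { x with values := Function.update x.values s (v ::ₘ x.values s) }

def NodeState.addToReports {m : ℕ} (x : NodeState m) (s : ℕ) (A : Multiset (Point m)) :
    NodeState m :=
  { x with reports := Function.update x.reports s (A ::ₘ x.reports s) }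

/-- The background thread: the effect of receiving the message `M`.
A terminated node does not react any more. -/
def receive {m : ℕ} (S : Setup m) (M : Msg m) (x : NodeState m) : NodeState m :=
  match x.phase, M with
  | .terminated, _ => x
  | _, .initValue v =>
      if S.exVal v = true then
        let y := x.addToValues 0 v
        if (y.values 0).card = S.n - S.t then y.broadcast (.report ⟨y.values 0, 0⟩) else y
      else x
  | _, .enough e =>
      let y := { x with terminationTimes := e ::ₘ x.terminationTimes }
      if S.n - S.t ≤ y.terminationTimes.card then
        { y with halt := nextSmallest S.t y.terminationTimes }
      else y
  | _, .value M => { x with waitingValues := M ::ₘ x.waitingValues }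
  | _, .report M => { x with waitingReports := M ::ₘ x.waitingReports }

/-- The check of a value message against the current state. -/
def valueReady {m : ℕ} (S : Setup m) (x : NodeState m) (M : ValueMsg m) : Prop :=
  M.round ≤ x.r ∧
  S.n - S.t ≤ M.recVals.card ∧
  S.n - S.t ≤ M.recReps.card ∧
  (∀ A ∈ M.recReps, A ≤ M.recVals) ∧
  M.recVals ≤ x.values (M.round - 1) ∧
  M.recReps ≤ x.reports (M.round - 1) ∧
  ((M.round = 1 ∧ M.point ∈ convexHull ℝ {p | p ∈ elim S.furthest S.t M.recVals}) ∨
    (1 < M.round ∧ M.point = vote M.recVals))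

/-- The check of a report message against the current state. -/
def reportReady {m : ℕ} (S : Setup m) (x : NodeState m) (M : ReportMsg m) : Prop :=
  M.round ≤ x.r ∧ S.n - S.t ≤ M.recVals.card ∧ M.recVals ≤ x.values M.round

open scoped Classical in
/-- Accept a waiting round `0` report during the initialization. The `(n-t)`-th one triggers the
computation of the first vote and of the estimate of the number of rounds. -/
def acceptInitReport {m : ℕ} (S : Setup m) (M : ReportMsg m) (x : NodeState m) : NodeState m :=
  let y := { x with waitingReports := x.waitingReports.erase M }.addToReports 0 M.recVals
  if (y.reports 0).card = S.n - S.t then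
    { y with
      vote := vote (elim S.furthest S.t (y.values 0))
      voteVals := y.values 0
      voteReps := y.reports 0 }.broadcast (.enough (enoughRounds S.ε (y.values 0)))
  else y

/-- Broadcast the current vote with the values and reports from which it was computed. -/
def broadcastVote {m : ℕ} (x : NodeState m) : NodeState m :=
  x.broadcast (.value ⟨x.vote, x.voteVals, x.voteReps, x.r⟩)

open scoped Classical in
/-- Accept a waiting value message in the main loop. The `(n-t)`-th value of the current round
triggers the report. -/
def acceptValue {m : ℕ} (S : Setup m) (M : ValueMsg m) (x : NodeState m) : NodeState m :=
  let y := { x with waitingValues := x.waitingValues.erase M }.addToValues M.round M.point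
  if M.round = x.r ∧ (y.values x.r).card = S.n - S.t then
    y.broadcast (.report ⟨y.values x.r, x.r⟩)
  else y

open scoped Classical in
/-- Accept a waiting report message in the main loop. The `(n-t)`-th report of the current round
completes the round: the next vote is computed and broadcast. -/
def acceptReport {m : ℕ} (S : Setup m) (M : ReportMsg m) (x : NodeState m) : NodeState m :=
  let y := { x with waitingReports := x.waitingReports.erase M }.addToReports M.round M.recVals
  if M.round = x.r ∧ (y.reports x.r).card = S.n - S.t then
    broadcastVote { y with
      r := x.r + 1
      vote := vote (y.values x.r)
      voteVals := y.values x.r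
      voteReps := y.reports x.r }
  else y

/-- One step of the main thread of a node. The order in which a for loop takes the waiting messages
is arbitrary; it ends when no waiting message passes the check. -/
inductive LocalStep {m : ℕ} (S : Setup m) : NodeState m → NodeState m → Prop
  | start (x : NodeState m) : x.phase = .start →
      LocalStep S x ((x.broadcast (.initValue x.vote)).goto .initHead)
  | initContinue (x : NodeState m) : x.phase = .initHead →
      (x.terminationTimes.card < S.n - S.t ∨ (x.reports 0).card < S.n - S.t) →
      LocalStep S x (x.goto .initLoop)
  | initReport (x : NodeState m) (M : ReportMsg m) : x.phase = .initLoop →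
      M ∈ x.waitingReports → M.round = 0 → reportReady S x M →
      LocalStep S x (acceptInitReport S M x)
  | initLoopEnd (x : NodeState m) : x.phase = .initLoop →
      (∀ M ∈ x.waitingReports, M.round = 0 → ¬ reportReady S x M) →
      LocalStep S x (x.goto .initHead)
  | initComplete (x : NodeState m) : x.phase = .initHead →
      S.n - S.t ≤ x.terminationTimes.card → S.n - S.t ≤ (x.reports 0).card →
      LocalStep S x ((broadcastVote { x with r := 1 }).goto .mainHead)
  | mainContinue (x : NodeState m) : x.phase = .mainHead → ((x.r : ℝ) : EReal) < x.halt →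
      LocalStep S x (x.goto .valueLoop)
  | value (x : NodeState m) (M : ValueMsg m) : x.phase = .valueLoop →
      M ∈ x.waitingValues → valueReady S x M →
      LocalStep S x (acceptValue S M x)
  | valueLoopEnd (x : NodeState m) : x.phase = .valueLoop →
      (∀ M ∈ x.waitingValues, ¬ valueReady S x M) →
      LocalStep S x (x.goto .reportLoop)
  | report (x : NodeState m) (M : ReportMsg m) : x.phase = .reportLoop →
      M ∈ x.waitingReports → reportReady S x M →
      LocalStep S x (acceptReport S M x)
  | reportLoopEnd (x : NodeState m) : x.phase = .reportLoop →
      (∀ M ∈ x.waitingReports, ¬ reportReady S x M) →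
      LocalStep S x (x.goto .mainHead)
  | terminate (x : NodeState m) : x.phase = .mainHead → x.halt ≤ ((x.r : ℝ) : EReal) →
      LocalStep S x (x.goto .terminated)

/-! ### Asynchronous executions with Byzantine nodes -/

/-- What happens at one moment: the broadcast `M` of `j` is received by `i`, or `i` makes a step of
its main thread, or nothing happens. -/
inductive Event (n m : ℕ) where
  | deliver (i j : Fin n) (M : Msg m)
  | act (i : Fin n)
  | idle

/-- The transitions of the states of the nonfaulty nodes. -/
def GlobalStep {m : ℕ} (S : Setup m) (faulty : Finset (Fin S.n)) (e : Event S.n m)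
    (x y : Fin S.n → NodeState m) : Prop :=
  match e with
  | .deliver i _ M => i ∉ faulty ∧ y i = receive S M (x i) ∧
      ∀ k, k ∉ faulty → k ≠ i → y k = x k
  | .act i => i ∉ faulty ∧ LocalStep S (x i) (y i) ∧
      ∀ k, k ∉ faulty → k ≠ i → y k = x k
  | .idle => ∀ k, k ∉ faulty → y k = x k

/-- An execution in which the nodes outside `faulty` follow the code. The scheduling, and the
broadcasts received from the nodes in `faulty`, are arbitrary within the rules of the broadcast
channels. The values of `state` at faulty nodes have no meaning. -/
structure Execution {m : ℕ} (S : Setup m) (faulty : Finset (Fin S.n))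
    (input : Fin S.n → Point m) where
  state : ℕ → Fin S.n → NodeState m
  event : ℕ → Event S.n m
  initially : ∀ i, i ∉ faulty → state 0 i = NodeState.initial (input i)
  step : ∀ k, GlobalStep S faulty (event k) (state k) (state (k + 1))
  /-- Validity: a broadcast received from a nonfaulty node was sent by it. -/
  authentic : ∀ k i j M, event k = .deliver i j M → j ∉ faulty → M ∈ (state k j).sent
  /-- Uniqueness: broadcasts received from the same node with the same tag are equal. -/
  unique : ∀ k k' i i' j M M', event k = .deliver i j M → event k' = .deliver i' j M' →
    M.tag = M'.tag → M = M'
  /-- A broadcast is received at most once by each node. -/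
  once : ∀ k k' i j M, event k = .deliver i j M → event k' = .deliver i j M → k = k'

/-- The liveness assumptions of the asynchronous model. -/
structure Execution.Fair {m : ℕ} {S : Setup m} {faulty : Finset (Fin S.n)}
    {input : Fin S.n → Point m} (E : Execution S faulty input) : Prop where
  /-- Validity: a broadcast of a nonfaulty node is received by every nonfaulty node. -/
  delivery : ∀ k i j M, i ∉ faulty → j ∉ faulty → M ∈ (E.state k j).sent →
    ∃ k', E.event k' = .deliver i j M
  /-- Liveness: a broadcast received by one nonfaulty node is received by all of them. -/
  totality : ∀ k i i' j M, i' ∉ faulty → E.event k = .deliver i j M →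
    ∃ k', E.event k' = .deliver i' j M
  /-- A nonfaulty node keeps making steps as long as it has not terminated. -/
  progress : ∀ k i, i ∉ faulty →
    ∃ k', k ≤ k' ∧ (E.event k' = .act i ∨ (E.state k' i).phase = .terminated)

/-- `⌈log₂ (3 D / ε)⌉ + 1`, but at least `1`, where `log₂ 0 = -∞`. -/
def roundBound (D ε : ℝ) : ℤ :=
  if D = 0 then 1 else max 1 (⌈Real.logb 2 (3 * D / ε)⌉ + 1)

end ApproxAgreement

end

/-! Everything rests on one inductive invariant `NodeInv` of a single nonfaulty node. It records
that received messages are either waiting or accepted, that accepted and sent messages pass the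
node's own check, and that reaching a threshold has caused the corresponding broadcast. The checks
compare a message with data that only grow (`Grows`), so a message that is ready once stays ready.

Round bound. An estimate sent by a nonfaulty node is computed from valid points, hence is at most
the estimate for `diam V`. At most `t` of the estimates a node receives come from faulty nodes.
Among `n - t` or more estimates, at least `n - 2t ≥ t + 1` therefore respect the bound, and so does
the `(t+1)`-th smallest (`Execution.halt_le`). Each pass of the main loop starts with `r < halt` and
advances the round at most once, because a new round has no values yet and no report of it can pass
the check (`RoundInv`).

Termination. Suppose a nonfaulty node never terminates. By uniqueness it accepts at most `n` values
and `n` reports per round, so each of its for loops ends (`Runs.leaves`) and it keeps finding its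
waiting lists free of ready messages. By induction on the round, whatever a nonfaulty node holds is
eventually held by it too (`Runs.eventually_le`), so the broadcasts of all nonfaulty nodes
eventually pass its check. A node that has terminated is in a later round than any running node ever
reaches (`Runs.round_lt`), so it has already sent all the messages a running node waits for. Hence
running nodes pass through every round (`Runs.exists_le_round`). But they eventually hold `n - t >
t` finite estimates, so `halt` stays below a fixed number, contradicting the loop test (`not_runs`).
-/

namespace ApproxAgreement

/-! ### Message contents, growth of the local data, persistence of the checks. -/

open scoped Classical in
/-- The externally valid input carried by a message. -/
def Msg.validInput? {m : ℕ} (S : Setup m) : Msg m → Option (Point m)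
  | .initValue v => if S.exVal v = true then some v else none
  | _ => none

/-- The estimate of the number of rounds carried by a message. -/
def Msg.estimate? {m : ℕ} : Msg m → Option EReal
  | .enough e => some e
  | _ => none

/-- The value message carried by a message. -/
def Msg.value? {m : ℕ} : Msg m → Option (ValueMsg m)
  | .value M => some M
  | _ => none

/-- The report message carried by a message. -/
def Msg.report? {m : ℕ} : Msg m → Option (ReportMsg m)
  | .report M => some M
  | _ => none

/-- The phases after the initialization. -/
def Phase.IsMain : Phase → Prop
  | .start => False
  | .initHead => False
  | .initLoop => False
  | _ => True

/-- The data of a node that only grow during an execution. -/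
structure Grows {m : ℕ} (x y : NodeState m) : Prop where
  r : x.r ≤ y.r
  values : ∀ s, x.values s ≤ y.values s
  reports : ∀ s, x.reports s ≤ y.reports s
  times : x.terminationTimes ≤ y.terminationTimes
  sent : ∀ M ∈ x.sent, M ∈ y.sent

theorem Grows.refl {m : ℕ} (x : NodeState m) : Grows x x :=
  ⟨le_rfl, fun _ => le_rfl, fun _ => le_rfl, le_rfl, fun _ h => h⟩

theorem Grows.trans {m : ℕ} {x y z : NodeState m} (h : Grows x y) (h' : Grows y z) : Grows x z :=
  ⟨h.r.trans h'.r, fun s => (h.values s).trans (h'.values s),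
    fun s => (h.reports s).trans (h'.reports s), h.times.trans h'.times,
    fun M hM => h'.sent M (h.sent M hM)⟩

/-- The inclusions are needed only in round `M.round - 1` and are not tied to `Grows`: the lemma
also compares states of two different nodes, and a state with the same state after its round is
overwritten by `1`. -/
theorem valueReady.mono {m : ℕ} {S : Setup m} {x y : NodeState m} {M : ValueMsg m}
    (h : valueReady S x M) (hr : M.round ≤ y.r)
    (hv : M.recVals ≤ x.values (M.round - 1) → M.recVals ≤ y.values (M.round - 1))
    (hR : M.recReps ≤ x.reports (M.round - 1) → M.recReps ≤ y.reports (M.round - 1)) :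
    valueReady S y M :=
  ⟨hr, h.2.1, h.2.2.1, h.2.2.2.1, hv h.2.2.2.2.1, hR h.2.2.2.2.2.1, h.2.2.2.2.2.2⟩

theorem valueReady.grows {m : ℕ} {S : Setup m} {x y : NodeState m} {M : ValueMsg m}
    (h : valueReady S x M) (g : Grows x y) : valueReady S y M :=
  h.mono (h.1.trans g.r) (fun h => h.trans (g.values _)) (fun h => h.trans (g.reports _))

theorem reportReady.grows {m : ℕ} {S : Setup m} {x y : NodeState m} {M : ReportMsg m}
    (h : reportReady S x M) (g : Grows x y) : reportReady S y M :=
  ⟨h.1.trans g.r, h.2.1, h.2.2.trans (g.values _)⟩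

theorem valueReady.one_le {m : ℕ} {S : Setup m} {x : NodeState m} {M : ValueMsg m}
    (h : valueReady S x M) : 1 ≤ M.round := by
  rcases h.2.2.2.2.2.2 with h | h
  · exact h.1.ge
  · exact h.1.le

theorem Grows.goto {m : ℕ} (x : NodeState m) (p : Phase) : Grows x (x.goto p) :=
  ⟨le_rfl, fun _ => le_rfl, fun _ => le_rfl, le_rfl, fun _ h => h⟩

theorem Grows.broadcast {m : ℕ} (x : NodeState m) (M : Msg m) : Grows x (x.broadcast M) :=
  ⟨le_rfl, fun _ => le_rfl, fun _ => le_rfl, le_rfl, fun _ h => List.mem_cons_of_mem _ h⟩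

theorem Grows.addToValues {m : ℕ} (x : NodeState m) (s : ℕ) (v : Point m) :
    Grows x (x.addToValues s v) := by
  refine ⟨le_rfl, fun s' => ?_, fun _ => le_rfl, le_rfl, fun _ h => h⟩
  simp only [NodeState.addToValues, Function.update_apply]
  split_ifs with h
  · exact h ▸ Multiset.le_cons_self _ _
  · exact le_rfl

theorem Grows.addToReports {m : ℕ} (x : NodeState m) (s : ℕ) (A : Multiset (Point m)) :
    Grows x (x.addToReports s A) := by
  refine ⟨le_rfl, fun _ => le_rfl, fun s' => ?_, le_rfl, fun _ h => h⟩
  simp only [NodeState.addToReports, Function.update_apply]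
  split_ifs with h
  · exact h ▸ Multiset.le_cons_self _ _
  · exact le_rfl

theorem Grows.acceptInitReport {m : ℕ} (S : Setup m) (M : ReportMsg m) (x : NodeState m) :
    Grows x (acceptInitReport S M x) := by
  have h := Grows.addToReports x 0 M.recVals
  unfold ApproxAgreement.acceptInitReport
  dsimp only
  split_ifs
  · exact ⟨h.r, h.values, h.reports, h.times, fun _ h => List.mem_cons_of_mem _ h⟩
  · exact ⟨h.r, h.values, h.reports, h.times, h.sent⟩

theorem Grows.acceptValue {m : ℕ} (S : Setup m) (M : ValueMsg m) (x : NodeState m) :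
    Grows x (acceptValue S M x) := by
  have h := Grows.addToValues x M.round M.point
  unfold ApproxAgreement.acceptValue
  dsimp only
  split_ifs
  · exact ⟨h.r, h.values, h.reports, h.times, fun _ h => List.mem_cons_of_mem _ h⟩
  · exact ⟨h.r, h.values, h.reports, h.times, h.sent⟩

theorem Grows.acceptReport {m : ℕ} (S : Setup m) (M : ReportMsg m) (x : NodeState m) :
    Grows x (acceptReport S M x) := by
  have h := Grows.addToReports x M.round M.recVals
  unfold ApproxAgreement.acceptReport
  dsimp only
  split_ifs
  · exact ⟨Nat.le_succ _, h.values, h.reports, h.times, fun _ h => List.mem_cons_of_mem _ h⟩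
  · exact ⟨h.r, h.values, h.reports, h.times, h.sent⟩

theorem Grows.receive {m : ℕ} (S : Setup m) (M : Msg m) (x : NodeState m) :
    Grows x (receive S M x) := by
  by_cases hp : x.phase = .terminated
  · simp only [ApproxAgreement.receive, hp]; exact .refl x
  cases M with
  | initValue v =>
    simp only [ApproxAgreement.receive]
    split_ifs
    · exact (Grows.addToValues x 0 v).trans (Grows.broadcast _ _)
    · exact Grows.addToValues x 0 v
    · exact .refl x
  | enough e =>
    simp only [ApproxAgreement.receive]
    split_ifs
    · exact ⟨le_rfl, fun _ => le_rfl, fun _ => le_rfl, Multiset.le_cons_self _ _, fun _ h => h⟩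
    · exact ⟨le_rfl, fun _ => le_rfl, fun _ => le_rfl, Multiset.le_cons_self _ _, fun _ h => h⟩
  | value M =>
    simp only [ApproxAgreement.receive]
    exact ⟨le_rfl, fun _ => le_rfl, fun _ => le_rfl, le_rfl, fun _ h => h⟩
  | report M =>
    simp only [ApproxAgreement.receive]
    exact ⟨le_rfl, fun _ => le_rfl, fun _ => le_rfl, le_rfl, fun _ h => h⟩

/-! ### The invariant of a single node and its preservation. -/

/-- The facts about the local state of a node with input `v` that has received the messages `H`. -/
structure NodeInv {m : ℕ} (S : Setup m) (v : Point m) (H : Multiset (Msg m))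
    (x : NodeState m) : Prop where
  values_zero : x.values 0 = H.filterMap (Msg.validInput? S)
  times : x.terminationTimes = H.filterMap Msg.estimate?
  halt : S.n - S.t ≤ x.terminationTimes.card → x.halt = nextSmallest S.t x.terminationTimes
  -- `a` is the multiset of accepted messages; reception enlarges the waiting part, acceptance moves
  -- one message into `a`.
  accepted_values : ∃ a, H.filterMap Msg.value? = x.waitingValues + a ∧
    (∀ s, 1 ≤ s → x.values s = (a.filter (fun M => M.round = s)).map ValueMsg.point) ∧
    ∀ M ∈ a, valueReady S x M
  accepted_reports : ∃ a, H.filterMap Msg.report? = x.waitingReports + a ∧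
    (∀ s, x.reports s = (a.filter (fun M => M.round = s)).map ReportMsg.recVals) ∧
    ∀ M ∈ a, reportReady S x M
  sent_value : ∀ M, Msg.value M ∈ x.sent → valueReady S x M
  sent_report : ∀ M, Msg.report M ∈ x.sent → reportReady S x M
  sent_enough : ∀ e, Msg.enough e ∈ x.sent →
    ∃ A : Multiset (Point m), e = enoughRounds S.ε A ∧ ∀ p ∈ A, p ∈ S.validInputs
  vote_start : x.phase = .start → x.vote = v
  input_sent : x.phase ≠ .start → Msg.initValue v ∈ x.sent
  report_sent : ∀ s, S.n - S.t ≤ (x.values s).card → ∃ M, Msg.report M ∈ x.sent ∧ M.round = s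
  value_sent : ∀ s, 1 ≤ s → s ≤ x.r → ∃ M, Msg.value M ∈ x.sent ∧ M.round = s
  estimate_sent : S.n - S.t ≤ (x.reports 0).card → ∃ e, Msg.enough e ∈ x.sent
  full_reports : ∀ s, s < x.r → S.n - S.t ≤ (x.reports s).card
  current_reports : 1 ≤ x.r → (x.reports x.r).card < S.n - S.t
  future_values : ∀ s, x.r < s → x.values s = 0
  main_round : x.phase.IsMain → 1 ≤ x.r ∧ S.n - S.t ≤ x.terminationTimes.card
  init_round : ¬ x.phase.IsMain → x.r = 0
  terminated : x.phase = .terminated → x.halt ≤ ((x.r : ℝ) : EReal)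
  -- The first vote is fixed during the initialization but broadcast only when the round becomes
  -- `1`, so its readiness is recorded in advance for that round.
  first_vote : x.r = 0 → S.n - S.t ≤ (x.reports 0).card →
    valueReady S { x with r := 1 } ⟨x.vote, x.voteVals, x.voteReps, 1⟩

theorem NodeInv.initial {m : ℕ} (S : Setup m) (hpos : 0 < S.n - S.t) (v : Point m) :
    NodeInv S v 0 (NodeState.initial v) := by
  constructor <;>
    simp [NodeState.initial, Phase.IsMain, hpos] <;> omega

/-- An accepted report still passes the check in the present state. In particular no report of a
round beyond `r` is held. -/
theorem NodeInv.of_mem_reports {m : ℕ} {S : Setup m} {v : Point m} {H : Multiset (Msg m)}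
    {x : NodeState m} (h : NodeInv S v H x) {s : ℕ} {A : Multiset (Point m)}
    (hA : A ∈ x.reports s) : s ≤ x.r ∧ S.n - S.t ≤ A.card ∧ A ≤ x.values s := by
  obtain ⟨a, -, h2, h3⟩ := h.accepted_reports
  rw [h2] at hA
  obtain ⟨M, hM, rfl⟩ := Multiset.mem_map.1 hA
  obtain ⟨hM, rfl⟩ := Multiset.mem_filter.1 hM
  exact h3 M (by assumption)

theorem NodeInv.full_values {m : ℕ} {S : Setup m} (hpos : 0 < S.n - S.t) {v : Point m}
    {H : Multiset (Msg m)} {x : NodeState m} (h : NodeInv S v H x) {s : ℕ}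
    (hs : S.n - S.t ≤ (x.reports s).card) : S.n - S.t ≤ (x.values s).card := by
  obtain ⟨A, hA⟩ := Multiset.card_pos_iff_exists_mem.1 (hpos.trans_le hs)
  obtain ⟨-, h1, h2⟩ := h.of_mem_reports hA
  exact h1.trans (Multiset.card_le_card h2)

theorem NodeInv.goto {m : ℕ} {S : Setup m} {v : Point m} {H : Multiset (Msg m)}
    {x : NodeState m} (h : NodeInv S v H x) {p : Phase} (hp : p ≠ .start) (hx : x.phase ≠ .start)
    (hmain : p.IsMain ↔ x.phase.IsMain) (hterm : p = .terminated → x.halt ≤ ((x.r : ℝ) : EReal)) :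
    NodeInv S v H (x.goto p) :=
  { values_zero := h.values_zero
    times := h.times
    halt := h.halt
    accepted_values := h.accepted_values
    accepted_reports := h.accepted_reports
    sent_value := h.sent_value
    sent_report := h.sent_report
    sent_enough := h.sent_enough
    vote_start := fun h => (hp h).elim
    input_sent := fun _ => h.input_sent hx
    report_sent := h.report_sent
    value_sent := h.value_sent
    estimate_sent := h.estimate_sent
    full_reports := h.full_reports
    current_reports := h.current_reports
    future_values := h.future_values
    main_round := fun hq => h.main_round (hmain.1 hq)
    init_round := fun hq => h.init_round (fun hq' => hq (hmain.2 hq'))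
    terminated := hterm
    first_vote := h.first_vote }

theorem NodeInv.start {m : ℕ} {S : Setup m} {v : Point m} {H : Multiset (Msg m)}
    {x : NodeState m} (h : NodeInv S v H x) (hx : x.phase = .start) :
    NodeInv S v H ((x.broadcast (.initValue x.vote)).goto .initHead) :=
  { values_zero := h.values_zero
    times := h.times
    halt := h.halt
    accepted_values := h.accepted_values
    accepted_reports := h.accepted_reports
    sent_value := fun M hM => h.sent_value M (by simpa [NodeState.broadcast, NodeState.goto] using hM)
    sent_report := fun M hM =>
      h.sent_report M (by simpa [NodeState.broadcast, NodeState.goto] using hM)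
    sent_enough := fun M hM =>
      h.sent_enough M (by simpa [NodeState.broadcast, NodeState.goto] using hM)
    vote_start := fun h => by cases h
    input_sent := fun _ => by simp [NodeState.broadcast, NodeState.goto, h.vote_start hx]
    report_sent := fun s hs => (h.report_sent s hs).imp fun M hM =>
      ⟨List.mem_cons_of_mem _ hM.1, hM.2⟩
    value_sent := fun s hs hs' => (h.value_sent s hs hs').imp fun M hM =>
      ⟨List.mem_cons_of_mem _ hM.1, hM.2⟩
    estimate_sent := fun hs => (h.estimate_sent hs).imp fun M hM => List.mem_cons_of_mem _ hM
    full_reports := h.full_reports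
    current_reports := h.current_reports
    future_values := h.future_values
    main_round := fun hq => hq.elim
    init_round := fun _ => h.init_round (by rw [hx]; exact id)
    terminated := fun h => by cases h
    first_vote := h.first_vote }

theorem NodeInv.initComplete {m : ℕ} {S : Setup m} (hpos : 0 < S.n - S.t)
    {v : Point m} {H : Multiset (Msg m)}
    {x : NodeState m} (h : NodeInv S v H x) (hx : x.phase = .initHead)
    (ht : S.n - S.t ≤ x.terminationTimes.card) (hr : S.n - S.t ≤ (x.reports 0).card) :
    NodeInv S v H ((broadcastVote { x with r := 1 }).goto .mainHead) := by
  have hr0 : x.r = 0 := h.init_round (by rw [hx]; exact id)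
  have g : Grows x ((broadcastVote { x with r := 1 }).goto .mainHead) :=
    ⟨by rw [hr0]; exact Nat.zero_le _, fun _ => le_rfl, fun _ => le_rfl, le_rfl,
      fun _ h => List.mem_cons_of_mem _ h⟩
  exact
  { values_zero := h.values_zero
    times := h.times
    halt := h.halt
    accepted_values := by
      obtain ⟨a, h1, h2, h3⟩ := h.accepted_values
      exact ⟨a, h1, h2, fun M hM => (h3 M hM).grows g⟩
    accepted_reports := by
      obtain ⟨a, h1, h2, h3⟩ := h.accepted_reports
      exact ⟨a, h1, h2, fun M hM => (h3 M hM).grows g⟩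
    sent_value := fun M hM => by
      rcases List.mem_cons.1 hM with hM | hM
      · cases hM
        exact h.first_vote hr0 hr
      · exact (h.sent_value M hM).grows g
    sent_report := fun M hM => by
      rcases List.mem_cons.1 hM with hM | hM
      · cases hM
      · exact (h.sent_report M hM).grows g
    sent_enough := fun e he => by
      rcases List.mem_cons.1 he with he | he
      · cases he
      · exact h.sent_enough e he
    vote_start := fun h => by cases h
    input_sent := fun _ => g.sent _ (h.input_sent (by rw [hx]; simp))
    report_sent := fun s hs => (h.report_sent s hs).imp fun M hM => ⟨g.sent _ hM.1, hM.2⟩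
    value_sent := fun s hs hs' => ⟨_, List.mem_cons_self, le_antisymm hs hs'⟩
    estimate_sent := fun hs => (h.estimate_sent hs).imp fun M hM => g.sent _ hM
    full_reports := fun s hs => by
      have : s = 0 := Nat.lt_one_iff.1 hs
      exact this ▸ hr
    current_reports := fun _ => by
      change (x.reports 1).card < _
      -- While `r = 0` the check `s ≤ r` has kept out every report of round `1`.
      have : x.reports 1 = 0 := by
        refine Multiset.eq_zero_of_forall_notMem fun A hA => ?_
        have := (h.of_mem_reports hA).1
        omega
      rw [this]; exact hpos
    future_values := fun s hs => h.future_values s (by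
      have : 1 < s := hs
      omega)
    main_round := fun _ => ⟨le_rfl, ht⟩
    init_round := fun hq => (hq trivial).elim
    terminated := fun h => by cases h
    first_vote := fun h => by cases h }

theorem receive_of_terminated {m : ℕ} (S : Setup m) (M : Msg m) {x : NodeState m}
    (hx : x.phase = .terminated) : receive S M x = x := by
  simp only [receive, hx]

theorem receive_initValue {m : ℕ} (S : Setup m) (w : Point m) {x : NodeState m}
    (hx : x.phase ≠ .terminated) :
    receive S (.initValue w) x =
      if S.exVal w = true then
        if ((x.addToValues 0 w).values 0).card = S.n - S.t then
          (x.addToValues 0 w).broadcast (.report ⟨(x.addToValues 0 w).values 0, 0⟩)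
        else x.addToValues 0 w
      else x := by
  cases hp : x.phase <;> first | exact absurd hp hx | (simp only [receive, hp])

theorem receive_enough {m : ℕ} (S : Setup m) (e : EReal) {x : NodeState m}
    (hx : x.phase ≠ .terminated) :
    receive S (.enough e) x =
      if S.n - S.t ≤ (e ::ₘ x.terminationTimes).card then
        { x with
          terminationTimes := e ::ₘ x.terminationTimes
          halt := nextSmallest S.t (e ::ₘ x.terminationTimes) }
      else { x with terminationTimes := e ::ₘ x.terminationTimes } := by
  cases hp : x.phase <;> first | exact absurd hp hx | (simp only [receive, hp])

theorem receive_value {m : ℕ} (S : Setup m) (M : ValueMsg m) {x : NodeState m}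
    (hx : x.phase ≠ .terminated) :
    receive S (.value M) x = { x with waitingValues := M ::ₘ x.waitingValues } := by
  cases hp : x.phase <;> first | exact absurd hp hx | (simp only [receive, hp])

theorem receive_report {m : ℕ} (S : Setup m) (M : ReportMsg m) {x : NodeState m}
    (hx : x.phase ≠ .terminated) :
    receive S (.report M) x = { x with waitingReports := M ::ₘ x.waitingReports } := by
  cases hp : x.phase <;> first | exact absurd hp hx | (simp only [receive, hp])

theorem NodeInv.receive_initValue {m : ℕ} {S : Setup m}
    {v : Point m} {H : Multiset (Msg m)}
    {x : NodeState m} (h : NodeInv S v H x) (hx : x.phase ≠ .terminated) (w : Point m) :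
    NodeInv S v (.initValue w ::ₘ H) (receive S (.initValue w) x) := by
  have g := Grows.receive S (.initValue w) x
  have e := ApproxAgreement.receive_initValue S w hx
  have hval : (receive S (.initValue w) x).values 0 =
      (Msg.initValue w ::ₘ H).filterMap (Msg.validInput? S) := by
    rw [e]
    split_ifs with h1 h2 <;>
    simp [Msg.validInput?, h1, h.values_zero, NodeState.broadcast, NodeState.addToValues]
  have hval' : ∀ s, 1 ≤ s → (receive S (.initValue w) x).values s = x.values s := by
    intro s hs
    rw [e]
    have : s ≠ 0 := by omega
    split_ifs with h1 h2 <;>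
    simp [NodeState.broadcast, NodeState.addToValues, this]
  have hsent : (receive S (.initValue w) x).sent = x.sent ∨
      (receive S (.initValue w) x).sent =
        Msg.report ⟨(receive S (.initValue w) x).values 0, 0⟩ :: x.sent ∧
      ((receive S (.initValue w) x).values 0).card = S.n - S.t := by
    rw [e]
    split_ifs with h1 h2
    · right; exact ⟨rfl, h2⟩
    · left; rfl
    · left; rfl
  have hrep : ∃ s, (receive S (.initValue w) x) =
      { x with values := (receive S (.initValue w) x).values, sent := s } := by
    rw [e]
    split_ifs with h1 h2
    exacts [⟨_, rfl⟩, ⟨_, rfl⟩, ⟨_, rfl⟩]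
  -- The broadcast is triggered by equality with `n - t`. Values arrive one at a time, so the
  -- threshold cannot be jumped over.
  have hfirst : S.n - S.t ≤ ((receive S (.initValue w) x).values 0).card →
      S.n - S.t ≤ (x.values 0).card ∨
      (receive S (.initValue w) x).sent =
        Msg.report ⟨(receive S (.initValue w) x).values 0, 0⟩ :: x.sent := by
    rw [e]
    split_ifs with h1 h2
    · exact fun _ => .inr rfl
    · simp only [NodeState.addToValues, Function.update_self, Multiset.card_cons] at h2 ⊢
      intro h3; left; omega
    · exact .inl
  clear e
  generalize receive S (.initValue w) x = y at *
  obtain ⟨l, hy⟩ := hrep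
  have hr : y.r = x.r := by rw [hy]
  have hph : y.phase = x.phase := by rw [hy]
  have hreps : y.reports = x.reports := by rw [hy]
  have htt : y.terminationTimes = x.terminationTimes := by rw [hy]
  have hhalt : y.halt = x.halt := by rw [hy]
  have hwv : y.waitingValues = x.waitingValues := by rw [hy]
  have hwr : y.waitingReports = x.waitingReports := by rw [hy]
  have hvote : y.vote = x.vote := by rw [hy]
  have hvv : y.voteVals = x.voteVals := by rw [hy]
  have hvr : y.voteReps = x.voteReps := by rw [hy]
  clear hy
  exact
  { values_zero := hval
    times := by rw [htt, h.times]; exact (Multiset.filterMap_cons_none _ _ rfl).symm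
    halt := by rw [htt, hhalt]; exact h.halt
    accepted_values := by
      obtain ⟨a, h1, h2, h3⟩ := h.accepted_values
      refine ⟨a, ?_, fun s hs => (hval' s hs).trans (h2 s hs), fun M hM => (h3 M hM).grows g⟩
      rw [hwv, ← h1]; exact Multiset.filterMap_cons_none _ _ rfl
    accepted_reports := by
      obtain ⟨a, h1, h2, h3⟩ := h.accepted_reports
      refine ⟨a, ?_, fun s => by rw [hreps]; exact h2 s, fun M hM => (h3 M hM).grows g⟩
      rw [hwr, ← h1]; exact Multiset.filterMap_cons_none _ _ rfl
    sent_value := fun M hM => by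
      rcases hsent with hs | ⟨hs, -⟩ <;> rw [hs] at hM
      · exact (h.sent_value M hM).grows g
      · exact (h.sent_value M (by simpa using hM)).grows g
    sent_report := fun M hM => by
      rcases hsent with hs | ⟨hs, hc⟩ <;> rw [hs] at hM
      · exact (h.sent_report M hM).grows g
      · rcases List.mem_cons.1 hM with hM | hM
        · cases hM
          exact ⟨Nat.zero_le _, hc.ge, le_rfl⟩
        · exact (h.sent_report M hM).grows g
    sent_enough := fun M hM => by
      rcases hsent with hs | ⟨hs, -⟩ <;> rw [hs] at hM
      · exact h.sent_enough M hM
      · exact h.sent_enough M (by simpa using hM)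
    vote_start := by rw [hph, hvote]; exact h.vote_start
    input_sent := by rw [hph]; exact fun hp => g.sent _ (h.input_sent hp)
    report_sent := fun s hs => by
      have key : S.n - S.t ≤ (x.values s).card → ∃ M, Msg.report M ∈ y.sent ∧ M.round = s :=
        fun hs => (h.report_sent s hs).imp fun M hM => ⟨g.sent _ hM.1, hM.2⟩
      rcases Nat.eq_zero_or_pos s with rfl | hs0
      · rcases hfirst hs with h1 | h1
        · exact key h1
        · rw [h1]; exact ⟨_, List.mem_cons_self, rfl⟩
      · exact key (by rwa [hval' s hs0] at hs)
    value_sent := fun s hs hs' => (h.value_sent s hs (hr ▸ hs')).imp fun M hM =>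
      ⟨g.sent _ hM.1, hM.2⟩
    estimate_sent := fun hs => (h.estimate_sent (by rwa [hreps] at hs)).imp
      fun M hM => g.sent _ hM
    full_reports := by rw [hr, hreps]; exact h.full_reports
    current_reports := by rw [hr, hreps]; exact h.current_reports
    future_values := fun s hs => by
      rw [hr] at hs
      rw [hval' s (by omega)]; exact h.future_values s hs
    main_round := by rw [hr, hph, htt]; exact h.main_round
    init_round := by rw [hr, hph]; exact h.init_round
    terminated := by rw [hr, hph, hhalt]; exact h.terminated
    first_vote := fun h0 h1 => by
      rw [hreps] at h1
      rw [hr] at h0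
      rw [hvote, hvv, hvr]
      refine (h.first_vote h0 h1).mono le_rfl (fun h' => h'.trans (g.values 0))
        (fun h' => h'.trans (g.reports 0)) }

/-- Needed for a nonfaulty first vote to pass the check of round `1`. Indexing by positions in a
list gives repeated points their multiplicity, and all weights are equal. -/
theorem vote_mem_convexHull {m : ℕ} {A : Multiset (Point m)} (hA : 0 < A.card) :
    vote A ∈ convexHull ℝ {p | p ∈ A} := by
  induction A using Quotient.inductionOn with
  | h l =>
    have hl : (l.length : ℝ) ≠ 0 := by
      have : 0 < l.length := hA
      positivity
    have hsum : vote (↑l : Multiset (Point m)) =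
        ∑ i : Fin l.length, (l.length : ℝ)⁻¹ • l[i] := by
      simp only [vote, Multiset.coe_card, Multiset.sum_coe]
      rw [← Finset.smul_sum]
      congr 1
      exact (Fin.sum_univ_getElem l).symm
    change vote (↑l : Multiset (Point m)) ∈ _
    rw [hsum]
    refine (convex_convexHull ℝ _).sum_mem (fun _ _ => by positivity) ?_ fun i _ =>
      subset_convexHull ℝ _ ?_
    · simp [hl]
    · change l[i] ∈ l
      exact List.getElem_mem _

/-- Each truncated subtraction lowers the cardinality by at most two. Since `n - t > 2t`, the
elimination leaves a nonempty multiset to average. -/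
theorem card_le_card_elim_add {m : ℕ} (f : Multiset (Point m) → Point m × Point m) (t : ℕ)
    (A : Multiset (Point m)) : A.card ≤ (elim f t A).card + 2 * t := by
  classical
  induction t generalizing A with
  | zero => simp [elim]
  | succ t ih =>
    rw [elim]
    refine le_trans ?_ (Nat.add_le_add_right (ih _) 2)
    have h := Multiset.card_le_card (le_tsub_add (a := ({(f A).1, (f A).2} : Multiset _)) (b := A))
    rw [Multiset.card_add, Multiset.card_pair] at h
    exact h

theorem NodeInv.receive_enough {m : ℕ} {S : Setup m} {v : Point m} {H : Multiset (Msg m)}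
    {x : NodeState m} (h : NodeInv S v H x) (hx : x.phase ≠ .terminated) (e : EReal) :
    NodeInv S v (.enough e ::ₘ H) (receive S (.enough e) x) := by
  have g := Grows.receive S (.enough e) x
  have h1 : ∃ c, receive S (.enough e) x =
      { x with terminationTimes := e ::ₘ x.terminationTimes, halt := c } ∧
      (S.n - S.t ≤ (e ::ₘ x.terminationTimes).card →
        c = nextSmallest S.t (e ::ₘ x.terminationTimes)) := by
    rw [ApproxAgreement.receive_enough S e hx]
    split_ifs with h1
    · exact ⟨_, rfl, fun _ => rfl⟩
    · exact ⟨_, rfl, fun h => (h1 h).elim⟩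
  obtain ⟨c, hc, hc'⟩ := h1
  rw [hc] at g ⊢
  exact
  { values_zero := h.values_zero.trans (Multiset.filterMap_cons_none _ _ rfl).symm
    times := by
      rw [Multiset.filterMap_cons_some Msg.estimate? _ _ rfl, ← h.times]
    halt := hc'
    accepted_values := by
      rw [Multiset.filterMap_cons_none _ _ rfl]; exact h.accepted_values
    accepted_reports := by
      rw [Multiset.filterMap_cons_none _ _ rfl]; exact h.accepted_reports
    sent_value := h.sent_value
    sent_report := h.sent_report
    sent_enough := h.sent_enough
    vote_start := h.vote_start
    input_sent := h.input_sent
    report_sent := h.report_sent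
    value_sent := h.value_sent
    estimate_sent := h.estimate_sent
    full_reports := h.full_reports
    current_reports := h.current_reports
    future_values := h.future_values
    main_round := fun hp => ⟨(h.main_round hp).1,
      (h.main_round hp).2.trans (Multiset.card_le_card g.times)⟩
    init_round := h.init_round
    terminated := fun hp => (hx hp).elim
    first_vote := h.first_vote }

theorem NodeInv.receive_value {m : ℕ} {S : Setup m} {v : Point m} {H : Multiset (Msg m)}
    {x : NodeState m} (h : NodeInv S v H x) (hx : x.phase ≠ .terminated) (M : ValueMsg m) :
    NodeInv S v (.value M ::ₘ H) (receive S (.value M) x) := by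
  rw [ApproxAgreement.receive_value S M hx]
  exact
  { values_zero := h.values_zero.trans (Multiset.filterMap_cons_none _ _ rfl).symm
    times := h.times.trans (Multiset.filterMap_cons_none _ _ rfl).symm
    halt := h.halt
    accepted_values := by
      rw [Multiset.filterMap_cons_some Msg.value? _ _ rfl]
      obtain ⟨a, h1, h2, h3⟩ := h.accepted_values
      exact ⟨a, by rw [h1, Multiset.cons_add], h2, h3⟩
    accepted_reports := by
      rw [Multiset.filterMap_cons_none _ _ rfl]; exact h.accepted_reports
    sent_value := h.sent_value
    sent_report := h.sent_report
    sent_enough := h.sent_enough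
    vote_start := h.vote_start
    input_sent := h.input_sent
    report_sent := h.report_sent
    value_sent := h.value_sent
    estimate_sent := h.estimate_sent
    full_reports := h.full_reports
    current_reports := h.current_reports
    future_values := h.future_values
    main_round := h.main_round
    init_round := h.init_round
    terminated := h.terminated
    first_vote := h.first_vote }

theorem NodeInv.receive_report {m : ℕ} {S : Setup m} {v : Point m} {H : Multiset (Msg m)}
    {x : NodeState m} (h : NodeInv S v H x) (hx : x.phase ≠ .terminated) (M : ReportMsg m) :
    NodeInv S v (.report M ::ₘ H) (receive S (.report M) x) := by
  rw [ApproxAgreement.receive_report S M hx]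
  exact
  { values_zero := h.values_zero.trans (Multiset.filterMap_cons_none _ _ rfl).symm
    times := h.times.trans (Multiset.filterMap_cons_none _ _ rfl).symm
    halt := h.halt
    accepted_values := by
      rw [Multiset.filterMap_cons_none _ _ rfl]; exact h.accepted_values
    accepted_reports := by
      rw [Multiset.filterMap_cons_some Msg.report? _ _ rfl]
      obtain ⟨a, h1, h2, h3⟩ := h.accepted_reports
      exact ⟨a, by rw [h1, Multiset.cons_add], h2, h3⟩
    sent_value := h.sent_value
    sent_report := h.sent_report
    sent_enough := h.sent_enough
    vote_start := h.vote_start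
    input_sent := h.input_sent
    report_sent := h.report_sent
    value_sent := h.value_sent
    estimate_sent := h.estimate_sent
    full_reports := h.full_reports
    current_reports := h.current_reports
    future_values := h.future_values
    main_round := h.main_round
    init_round := h.init_round
    terminated := h.terminated
    first_vote := h.first_vote }

theorem NodeInv.receive {m : ℕ} {S : Setup m} {v : Point m} {H : Multiset (Msg m)}
    {x : NodeState m} (h : NodeInv S v H x) (hx : x.phase ≠ .terminated) (M : Msg m) :
    NodeInv S v (M ::ₘ H) (receive S M x) := by
  cases M with
  | initValue w => exact h.receive_initValue hx w
  | enough e => exact h.receive_enough hx e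
  | value M => exact h.receive_value hx M
  | report M => exact h.receive_report hx M

theorem NodeInv.acceptValue {m : ℕ} {S : Setup m} (hpos : 0 < S.n - S.t)
    {v : Point m} {H : Multiset (Msg m)}
    {x : NodeState m} (h : NodeInv S v H x) (hx : x.phase = .valueLoop) {M : ValueMsg m}
    (hM : M ∈ x.waitingValues) (hMr : valueReady S x M) :
    NodeInv S v H (acceptValue S M x) := by
  classical
  have g := Grows.acceptValue S M x
  have hM1 := hMr.one_le
  have hval : (ApproxAgreement.acceptValue S M x).values =
      Function.update x.values M.round (M.point ::ₘ x.values M.round) := by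
    unfold ApproxAgreement.acceptValue; dsimp only; split_ifs <;> rfl
  have hsent : (ApproxAgreement.acceptValue S M x).sent = x.sent ∨
      (ApproxAgreement.acceptValue S M x).sent =
        Msg.report ⟨(ApproxAgreement.acceptValue S M x).values x.r, x.r⟩ :: x.sent ∧
      ((ApproxAgreement.acceptValue S M x).values x.r).card = S.n - S.t := by
    unfold ApproxAgreement.acceptValue
    dsimp only
    split_ifs with h2
    · right; exact ⟨rfl, h2.2⟩
    · left; rfl
  have hfirst : M.round = x.r → (M.point ::ₘ x.values M.round).card = S.n - S.t →
      (ApproxAgreement.acceptValue S M x).sent =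
        Msg.report ⟨(ApproxAgreement.acceptValue S M x).values x.r, x.r⟩ :: x.sent := by
    intro h1 h2
    unfold ApproxAgreement.acceptValue
    dsimp only
    rw [if_pos]
    · rfl
    · refine ⟨h1, ?_⟩
      rw [← h2, h1]
      simp [NodeState.addToValues]
  have hrest : ∃ s, (ApproxAgreement.acceptValue S M x) =
      { x with
        values := (ApproxAgreement.acceptValue S M x).values
        sent := s
        waitingValues := x.waitingValues.erase M } := by
    unfold ApproxAgreement.acceptValue
    dsimp only
    split_ifs
    exacts [⟨_, rfl⟩, ⟨_, rfl⟩]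
  generalize ApproxAgreement.acceptValue S M x = y at *
  obtain ⟨l, hy⟩ := hrest
  have hr : y.r = x.r := by rw [hy]
  have hph : y.phase = x.phase := by rw [hy]
  have hreps : y.reports = x.reports := by rw [hy]
  have htt : y.terminationTimes = x.terminationTimes := by rw [hy]
  have hhalt : y.halt = x.halt := by rw [hy]
  have hwv : y.waitingValues = x.waitingValues.erase M := by rw [hy]
  have hwr : y.waitingReports = x.waitingReports := by rw [hy]
  clear hy
  have hr1 : 1 ≤ x.r := (h.main_round (by rw [hx]; trivial)).1
  have hval0 : y.values 0 = x.values 0 := by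
    rw [hval, Function.update_of_ne (by omega)]
  exact
  { values_zero := hval0.trans h.values_zero
    times := htt.trans h.times
    halt := by rw [htt, hhalt]; exact h.halt
    accepted_values := by
      obtain ⟨a, h1, h2, h3⟩ := h.accepted_values
      refine ⟨M ::ₘ a, ?_, fun s hs => ?_, fun M' hM' => ?_⟩
      · rw [hwv, h1, ← Multiset.cons_erase hM]
        simp
      · rw [hval, Function.update_apply]
        split_ifs with hsM
        · subst hsM
          rw [Multiset.filter_cons_of_pos (p := fun M' : ValueMsg m => M'.round = M.round) _ rfl,
            Multiset.map_cons, h2 _ hs]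
        · rw [Multiset.filter_cons_of_neg (p := fun M' : ValueMsg m => M'.round = s) _
            (fun h => hsM h.symm), h2 _ hs]
      · rcases Multiset.mem_cons.1 hM' with rfl | hM'
        · exact hMr.grows g
        · exact (h3 _ hM').grows g
    accepted_reports := by
      obtain ⟨a, h1, h2, h3⟩ := h.accepted_reports
      exact ⟨a, hwr ▸ h1, fun s => by rw [hreps]; exact h2 s, fun M hM => (h3 M hM).grows g⟩
    sent_value := fun M hM => by
      rcases hsent with hs | ⟨hs, -⟩ <;> rw [hs] at hM
      · exact (h.sent_value M hM).grows g
      · exact (h.sent_value M (by simpa using hM)).grows g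
    sent_report := fun M hM => by
      rcases hsent with hs | ⟨hs, hc⟩ <;> rw [hs] at hM
      · exact (h.sent_report M hM).grows g
      · rcases List.mem_cons.1 hM with hM | hM
        · cases hM
          exact ⟨hr.ge, hc.ge, le_rfl⟩
        · exact (h.sent_report M hM).grows g
    sent_enough := fun M hM => by
      rcases hsent with hs | ⟨hs, -⟩ <;> rw [hs] at hM
      · exact h.sent_enough M hM
      · exact h.sent_enough M (by simpa using hM)
    vote_start := fun hp => by rw [hph, hx] at hp; cases hp
    input_sent := fun _ => g.sent _ (h.input_sent (by rw [hx]; simp))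
    report_sent := fun s hs => by
      have key : S.n - S.t ≤ (x.values s).card → ∃ M, Msg.report M ∈ y.sent ∧ M.round = s :=
        fun hs => (h.report_sent s hs).imp fun M hM => ⟨g.sent _ hM.1, hM.2⟩
      by_cases hsM : s = M.round
      · subst hsM
        by_cases hsc : S.n - S.t ≤ (x.values M.round).card
        · exact key hsc
        · rw [hval, Function.update_self] at hs
          -- A value of an earlier round cannot be the one that reaches the threshold: that round is
          -- complete, so its values already numbered `n - t`.
          rcases hMr.1.lt_or_eq with hlt | heq
          · exact (hsc (h.full_values hpos (h.full_reports _ hlt))).elim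
          · rw [hfirst heq (le_antisymm (by rw [Multiset.card_cons]; omega) hs)]
            exact ⟨_, List.mem_cons_self, heq.symm⟩
      · rw [hval, Function.update_of_ne hsM] at hs
        exact key hs
    value_sent := fun s hs hs' => (h.value_sent s hs (hr ▸ hs')).imp fun M hM =>
      ⟨g.sent _ hM.1, hM.2⟩
    estimate_sent := fun hs => (h.estimate_sent (by rwa [hreps] at hs)).imp
      fun M hM => g.sent _ hM
    full_reports := by rw [hr, hreps]; exact h.full_reports
    current_reports := by rw [hr, hreps]; exact h.current_reports
    future_values := fun s hs => by
      rw [hr] at hs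
      have := hMr.1
      rw [hval, Function.update_of_ne (by omega)]; exact h.future_values s hs
    main_round := by rw [hr, hph, htt]; exact h.main_round
    init_round := by rw [hr, hph]; exact h.init_round
    terminated := by rw [hr, hph, hhalt]; exact h.terminated
    first_vote := fun h0 _ => by omega }

theorem NodeInv.acceptReport {m : ℕ} {S : Setup m} (hpos : 0 < S.n - S.t)
    {v : Point m} {H : Multiset (Msg m)}
    {x : NodeState m} (h : NodeInv S v H x) (hx : x.phase = .reportLoop) {M : ReportMsg m}
    (hM : M ∈ x.waitingReports) (hMr : reportReady S x M) :
    NodeInv S v H (acceptReport S M x) := by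
  classical
  have g := Grows.acceptReport S M x
  have hr1 : 1 ≤ x.r := (h.main_round (by rw [hx]; trivial)).1
  have hreps : (ApproxAgreement.acceptReport S M x).reports =
      Function.update x.reports M.round (M.recVals ::ₘ x.reports M.round) := by
    unfold ApproxAgreement.acceptReport; dsimp only; split_ifs <;> rfl
  have hnew : ∀ A ∈ (ApproxAgreement.acceptReport S M x).reports x.r, A ≤ x.values x.r := by
    rw [hreps]
    intro A hA
    rw [Function.update_apply] at hA
    split_ifs at hA with hc
    · rcases Multiset.mem_cons.1 hA with rfl | hA
      · rw [hc]; exact hMr.2.2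
      · rw [hc]; exact (h.of_mem_reports hA).2.2
    · exact (h.of_mem_reports hA).2.2
  have hrest : ∃ r vt vv vr s, (ApproxAgreement.acceptReport S M x) =
      { x with
        r := r
        vote := vt
        voteVals := vv
        voteReps := vr
        reports := (ApproxAgreement.acceptReport S M x).reports
        sent := s
        waitingReports := x.waitingReports.erase M } ∧
      (r = x.r ∧ s = x.sent ∧
        ((ApproxAgreement.acceptReport S M x).reports x.r).card < S.n - S.t ∨
        r = x.r + 1 ∧ S.n - S.t ≤ (x.values x.r).card ∧
        ((ApproxAgreement.acceptReport S M x).reports x.r).card = S.n - S.t ∧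
        s = .value ⟨vote (x.values x.r), x.values x.r,
          (ApproxAgreement.acceptReport S M x).reports x.r, x.r + 1⟩ :: x.sent) := by
    -- Before the step the current round has fewer than `n - t` reports, so if the equality test
    -- fails after adding one, there are still fewer.
    have hcur := h.current_reports hr1
    rw [hreps]
    unfold ApproxAgreement.acceptReport
    dsimp only
    split_ifs with hc
    · refine ⟨_, _, _, _, _, rfl, .inr ⟨rfl, ?_, ?_, rfl⟩⟩
      · exact hMr.2.1.trans (Multiset.card_le_card (hc.1 ▸ hMr.2.2))
      · exact hc.2
    · refine ⟨_, _, _, _, _, rfl, .inl ⟨rfl, rfl, ?_⟩⟩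
      rw [Function.update_apply]
      split_ifs with hc'
      · have : ((Function.update x.reports M.round (M.recVals ::ₘ x.reports M.round)) x.r).card ≠
            S.n - S.t := fun h => hc ⟨hc'.symm, h⟩
        rw [hc', Function.update_self] at this
        rw [hc'] at hcur
        rw [Multiset.card_cons] at this ⊢
        omega
      · exact hcur
  generalize ApproxAgreement.acceptReport S M x = y at *
  obtain ⟨r, vt, vv, vr, l, hy, hc⟩ := hrest
  have hr : y.r = r := by rw [hy]
  have hsent : y.sent = l := by rw [hy]
  have hph : y.phase = x.phase := by rw [hy]
  have hval : y.values = x.values := by rw [hy]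
  have htt : y.terminationTimes = x.terminationTimes := by rw [hy]
  have hhalt : y.halt = x.halt := by rw [hy]
  have hwv : y.waitingValues = x.waitingValues := by rw [hy]
  have hwr : y.waitingReports = x.waitingReports.erase M := by rw [hy]
  clear hy
  subst hr hsent
  have hacc : ∃ a, H.filterMap Msg.report? = y.waitingReports + a ∧
      (∀ s, y.reports s = (a.filter (fun M => M.round = s)).map ReportMsg.recVals) ∧
      ∀ M ∈ a, reportReady S y M := by
    obtain ⟨a, h1, h2, h3⟩ := h.accepted_reports
    refine ⟨M ::ₘ a, ?_, fun s => ?_, fun M' hM' => ?_⟩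
    · rw [hwr, h1, ← Multiset.cons_erase hM]
      simp
    · rw [hreps, Function.update_apply]
      split_ifs with hsM
      · subst hsM
        rw [Multiset.filter_cons_of_pos (p := fun M' : ReportMsg m => M'.round = M.round) _ rfl,
          Multiset.map_cons, h2]
      · rw [Multiset.filter_cons_of_neg (p := fun M' : ReportMsg m => M'.round = s) _
          (fun h => hsM h.symm), h2]
    · rcases Multiset.mem_cons.1 hM' with rfl | hM'
      · exact hMr.grows g
      · exact (h3 _ hM').grows g
  exact
  { values_zero := by rw [hval]; exact h.values_zero
    times := htt.trans h.times
    halt := by rw [htt, hhalt]; exact h.halt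
    accepted_values := by
      obtain ⟨a, h1, h2, h3⟩ := h.accepted_values
      exact ⟨a, hwv ▸ h1, by rw [hval]; exact h2, fun M hM => (h3 M hM).grows g⟩
    accepted_reports := hacc
    sent_value := fun M hM => by
      rcases hc with ⟨-, hs, -⟩ | ⟨hs1, hs2, hs3, hs⟩ <;> rw [hs] at hM
      · exact (h.sent_value M hM).grows g
      · rcases List.mem_cons.1 hM with hM | hM
        · cases hM
          -- The new round is at least `2`, so the check asks for the plain average, which is what
          -- was computed.
          refine ⟨hs1.ge, hs2, hs3.ge, hnew, ?_, le_rfl, .inr ⟨Nat.lt_succ_of_le hr1, rfl⟩⟩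
          rw [hval]; exact le_rfl
        · exact (h.sent_value M hM).grows g
    sent_report := fun M hM => by
      rcases hc with ⟨-, hs, -⟩ | ⟨hs1, hs2, hs3, hs⟩ <;> rw [hs] at hM
      · exact (h.sent_report M hM).grows g
      · exact (h.sent_report M (by simpa using hM)).grows g
    sent_enough := fun M hM => by
      rcases hc with ⟨-, hs, -⟩ | ⟨hs1, hs2, hs3, hs⟩ <;> rw [hs] at hM
      · exact h.sent_enough M hM
      · exact h.sent_enough M (by simpa using hM)
    vote_start := fun hp => by rw [hph, hx] at hp; cases hp
    input_sent := fun _ => g.sent _ (h.input_sent (by rw [hx]; simp))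
    report_sent := fun s hs => (h.report_sent s (by rwa [hval] at hs)).imp
      fun M hM => ⟨g.sent _ hM.1, hM.2⟩
    value_sent := fun s hs hs' => by
      by_cases hsr : s ≤ x.r
      · exact (h.value_sent s hs hsr).imp fun M hM => ⟨g.sent _ hM.1, hM.2⟩
      · rcases hc with ⟨h1, -, -⟩ | ⟨h1, -, -, h2⟩
        · omega
        · rw [h2]
          exact ⟨_, List.mem_cons_self, by change x.r + 1 = s; omega⟩
    estimate_sent := fun _ => (h.estimate_sent (h.full_reports 0 hr1)).imp
      fun M hM => g.sent _ hM
    full_reports := fun s hs => by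
      by_cases hsr : s < x.r
      · exact (h.full_reports s hsr).trans (Multiset.card_le_card (g.reports s))
      · rcases hc with ⟨h1, -, -⟩ | ⟨h1, -, h2, -⟩
        · omega
        · obtain rfl : s = x.r := by omega
          exact h2.ge
    current_reports := fun _ => by
      rcases hc with ⟨h1, -, h2⟩ | ⟨h1, -, h2, -⟩
      · rw [h1]; exact h2
      -- Reports of the round just entered were not acceptable until now, so the count restarts at
      -- zero.
      · have : y.reports y.r = 0 := by
          have hMr1 := hMr.1
          rw [hreps, h1, Function.update_of_ne (by omega)]
          refine Multiset.eq_zero_of_forall_notMem fun A hA => ?_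
          have := (h.of_mem_reports hA).1
          omega
        rw [this]; exact hpos
    future_values := fun s hs => by
      rw [hval]
      exact h.future_values s (g.r.trans_lt hs)
    main_round := fun _ => ⟨hr1.trans g.r, by
      rw [htt]; exact (h.main_round (by rw [hx]; trivial)).2⟩
    init_round := fun hp => by rw [hph, hx] at hp; exact (hp trivial).elim
    terminated := fun hp => by rw [hph, hx] at hp; cases hp
    first_vote := fun h0 _ => by have := g.r; omega }

theorem NodeInv.acceptInitReport {m : ℕ} {S : Setup m} (hn : 3 * S.t + 1 ≤ S.n)
    {v : Point m} {H : Multiset (Msg m)}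
    {x : NodeState m} (h : NodeInv S v H x) (hx : x.phase = .initLoop) {M : ReportMsg m}
    (hM : M ∈ x.waitingReports) (hM0 : M.round = 0) (hMr : reportReady S x M) :
    NodeInv S v H (acceptInitReport S M x) := by
  classical
  have hpos : 0 < S.n - S.t := by omega
  have g := Grows.acceptInitReport S M x
  have hr0 : x.r = 0 := h.init_round (by rw [hx]; exact id)
  have hcv : S.n - S.t ≤ (x.values 0).card :=
    hMr.2.1.trans (Multiset.card_le_card (hM0 ▸ hMr.2.2))
  have hreps : (ApproxAgreement.acceptInitReport S M x).reports =
      Function.update x.reports 0 (M.recVals ::ₘ x.reports 0) := by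
    unfold ApproxAgreement.acceptInitReport; dsimp only; split_ifs <;> rfl
  have hnew : ∀ A ∈ (ApproxAgreement.acceptInitReport S M x).reports 0, A ≤ x.values 0 := by
    rw [hreps]
    intro A hA
    rw [Function.update_self] at hA
    rcases Multiset.mem_cons.1 hA with rfl | hA
    · exact hM0 ▸ hMr.2.2
    · exact (h.of_mem_reports hA).2.2
  have hrest : ∃ vt vv vr s, (ApproxAgreement.acceptInitReport S M x) =
      { x with
        vote := vt
        voteVals := vv
        voteReps := vr
        reports := (ApproxAgreement.acceptInitReport S M x).reports
        sent := s
        waitingReports := x.waitingReports.erase M } ∧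
      (vt = x.vote ∧ vv = x.voteVals ∧ vr = x.voteReps ∧ s = x.sent ∧
        (S.n - S.t ≤ ((ApproxAgreement.acceptInitReport S M x).reports 0).card →
          S.n - S.t ≤ (x.reports 0).card) ∨
        vt = vote (elim S.furthest S.t (x.values 0)) ∧
        vv = x.values 0 ∧ vr = (ApproxAgreement.acceptInitReport S M x).reports 0 ∧
        ((ApproxAgreement.acceptInitReport S M x).reports 0).card = S.n - S.t ∧
        s = .enough (enoughRounds S.ε (x.values 0)) :: x.sent) := by
    rw [hreps]
    unfold ApproxAgreement.acceptInitReport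
    dsimp only
    split_ifs with hc
    · exact ⟨_, _, _, _, rfl, .inr ⟨rfl, rfl, rfl, hc, rfl⟩⟩
    · refine ⟨_, _, _, _, rfl, .inl ⟨rfl, rfl, rfl, rfl, fun h1 => ?_⟩⟩
      have hc' : (Function.update x.reports 0 (M.recVals ::ₘ x.reports 0) 0).card ≠ S.n - S.t := hc
      rw [Function.update_self, Multiset.card_cons] at h1 hc'
      omega
  generalize ApproxAgreement.acceptInitReport S M x = y at *
  obtain ⟨vt, vv, vr, l, hy, hc⟩ := hrest
  have hvt : y.vote = vt := by rw [hy]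
  have hvv : y.voteVals = vv := by rw [hy]
  have hvr : y.voteReps = vr := by rw [hy]
  have hr : y.r = x.r := by rw [hy]
  have hsent : y.sent = l := by rw [hy]
  have hph : y.phase = x.phase := by rw [hy]
  have hval : y.values = x.values := by rw [hy]
  have htt : y.terminationTimes = x.terminationTimes := by rw [hy]
  have hhalt : y.halt = x.halt := by rw [hy]
  have hwv : y.waitingValues = x.waitingValues := by rw [hy]
  have hwr : y.waitingReports = x.waitingReports.erase M := by rw [hy]
  clear hy
  subst hvt hvv hvr hsent
  have hacc : ∃ a, H.filterMap Msg.report? = y.waitingReports + a ∧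
      (∀ s, y.reports s = (a.filter (fun M => M.round = s)).map ReportMsg.recVals) ∧
      ∀ M ∈ a, reportReady S y M := by
    obtain ⟨a, h1, h2, h3⟩ := h.accepted_reports
    refine ⟨M ::ₘ a, ?_, fun s => ?_, fun M' hM' => ?_⟩
    · rw [hwr, h1, ← Multiset.cons_erase hM]
      simp
    · rw [hreps, Function.update_apply]
      split_ifs with hsM
      · subst hsM
        rw [Multiset.filter_cons_of_pos (p := fun M' : ReportMsg m => M'.round = 0) _ hM0,
          Multiset.map_cons, h2]
      · rw [Multiset.filter_cons_of_neg (p := fun M' : ReportMsg m => M'.round = s) _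
          (fun h => hsM (h.symm.trans hM0)), h2]
    · rcases Multiset.mem_cons.1 hM' with rfl | hM'
      · exact hMr.grows g
      · exact (h3 _ hM').grows g
  exact
  { values_zero := by rw [hval]; exact h.values_zero
    times := htt.trans h.times
    halt := by rw [htt, hhalt]; exact h.halt
    accepted_values := by
      obtain ⟨a, h1, h2, h3⟩ := h.accepted_values
      exact ⟨a, hwv ▸ h1, by rw [hval]; exact h2, fun M hM => (h3 M hM).grows g⟩
    accepted_reports := hacc
    sent_value := fun M hM => by
      rcases hc with ⟨-, -, -, hs, -⟩ | ⟨-, -, -, -, hs⟩ <;> rw [hs] at hM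
      · exact (h.sent_value M hM).grows g
      · exact (h.sent_value M (by simpa using hM)).grows g
    sent_report := fun M hM => by
      rcases hc with ⟨-, -, -, hs, -⟩ | ⟨-, -, -, -, hs⟩ <;> rw [hs] at hM
      · exact (h.sent_report M hM).grows g
      · exact (h.sent_report M (by simpa using hM)).grows g
    sent_enough := fun e he => by
      rcases hc with ⟨-, -, -, hs, -⟩ | ⟨-, -, -, -, hs⟩ <;> rw [hs] at he
      · exact h.sent_enough e he
      · rcases List.mem_cons.1 he with he | he
        · cases he
          -- Values of round `0` come from `initValue` messages that passed `exVal` on reception,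
          -- whoever sent them.
          refine ⟨_, rfl, fun p hp => ?_⟩
          rw [h.values_zero] at hp
          obtain ⟨M', -, hM'⟩ := (Multiset.mem_filterMap _ _).1 hp
          cases M' with
          | initValue w =>
            simp only [Msg.validInput?] at hM'
            split_ifs at hM' with hw
            cases hM'
            exact hw
          | _ => cases hM'
        · exact h.sent_enough e he
    vote_start := fun hp => by rw [hph, hx] at hp; cases hp
    input_sent := fun _ => g.sent _ (h.input_sent (by rw [hx]; simp))
    report_sent := fun s hs => (h.report_sent s (by rwa [hval] at hs)).imp
      fun M hM => ⟨g.sent _ hM.1, hM.2⟩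
    value_sent := fun s hs hs' => by omega
    estimate_sent := fun hs => by
      rcases hc with ⟨-, -, -, -, hs'⟩ | ⟨-, -, -, -, hs'⟩
      · exact (h.estimate_sent (hs' hs)).imp fun M hM => g.sent _ hM
      · rw [hs']; exact ⟨_, List.mem_cons_self⟩
    full_reports := fun s hs => by omega
    current_reports := fun hs => by omega
    future_values := fun s hs => by
      rw [hval]
      exact h.future_values s (g.r.trans_lt hs)
    main_round := fun hp => by rw [hph, hx] at hp; exact hp.elim
    init_round := fun hp => hr.trans hr0
    terminated := fun hp => by rw [hph, hx] at hp; cases hp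
    first_vote := fun _ h1 => by
      rcases hc with ⟨e1, e2, e3, -, hs⟩ | ⟨e1, e2, e3, hs, -⟩
      · rw [e1, e2, e3]
        -- A vote fixed earlier is not recomputed; its copies of values and reports remain contained
        -- in the growing multisets.
        exact (h.first_vote hr0 (hs h1)).mono le_rfl (fun h' => h'.trans (g.values 0))
          (fun h' => h'.trans (g.reports 0))
      · rw [e1, e2, e3]
        refine ⟨le_rfl, hcv, hs.ge, hnew, ?_, le_rfl, .inl ⟨rfl, vote_mem_convexHull ?_⟩⟩
        · rw [hval]; exact le_rfl
        · have := card_le_card_elim_add S.furthest S.t (x.values 0)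
          change _ ≤ Multiset.card (x.values 0) at hcv
          change 0 < (elim S.furthest S.t (x.values 0)).card
          omega }

theorem NodeInv.localStep {m : ℕ} {S : Setup m} (hn : 3 * S.t + 1 ≤ S.n)
    {v : Point m} {H : Multiset (Msg m)} {x y : NodeState m} (h : NodeInv S v H x)
    (hxy : LocalStep S x y) : NodeInv S v H y := by
  have hpos : 0 < S.n - S.t := by omega
  cases hxy with
  | start hx => exact h.start hx
  | initContinue hx => exact h.goto (by simp) (by simp [hx]) (by simp [hx, Phase.IsMain]) (by simp)
  | initReport M hx hM hM0 hMr => exact h.acceptInitReport hn hx hM hM0 hMr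
  | initLoopEnd hx => exact h.goto (by simp) (by simp [hx]) (by simp [hx, Phase.IsMain]) (by simp)
  | initComplete hx ht hr => exact h.initComplete hpos hx ht hr
  | mainContinue hx => exact h.goto (by simp) (by simp [hx]) (by simp [hx, Phase.IsMain]) (by simp)
  | value M hx hM hMr => exact h.acceptValue hpos hx hM hMr
  | valueLoopEnd hx => exact h.goto (by simp) (by simp [hx]) (by simp [hx, Phase.IsMain]) (by simp)
  | report M hx hM hMr => exact h.acceptReport hpos hx hM hMr
  | reportLoopEnd hx => exact h.goto (by simp) (by simp [hx]) (by simp [hx, Phase.IsMain]) (by simp)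
  | terminate hx hh =>
    exact h.goto (by simp) (by simp [hx]) (by simp [hx, Phase.IsMain]) (fun _ => hh)

/-- The invariant is needed only for `initComplete`, which overwrites `r` by `1`: before it, `r =
0`. -/
theorem NodeInv.grows {m : ℕ} {S : Setup m}
    {v : Point m} {H : Multiset (Msg m)} {x y : NodeState m} (h : NodeInv S v H x)
    (hxy : LocalStep S x y) : Grows x y := by
  cases hxy with
  | start hx => exact (Grows.broadcast _ _).trans (Grows.goto _ _)
  | initReport M hx hM hM0 hMr => exact Grows.acceptInitReport S M x
  | initComplete hx ht hr =>
    exact ⟨by rw [h.init_round (by rw [hx]; exact id)]; exact Nat.zero_le _, fun _ => le_rfl,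
      fun _ => le_rfl, le_rfl, fun _ h => List.mem_cons_of_mem _ h⟩
  | value M hx hM hMr => exact Grows.acceptValue S M x
  | report M hx hM hMr => exact Grows.acceptReport S M x
  | _ => exact Grows.goto x _

/-! ### Effect of a reception, order statistics and counting. -/

theorem receive_frame {m : ℕ} (S : Setup m) (M : Msg m) (x : NodeState m) :
    (receive S M x).r = x.r ∧ (receive S M x).phase = x.phase ∧
      ∀ s, 1 ≤ s → (receive S M x).values s = x.values s := by
  by_cases hx : x.phase = .terminated
  · rw [receive_of_terminated S M hx]; exact ⟨rfl, rfl, fun _ _ => rfl⟩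
  cases M with
  | initValue v =>
    have : ∀ s, 1 ≤ s → s ≠ 0 := fun s hs => by omega
    rw [receive_initValue S v hx]
    split_ifs
    · exact ⟨rfl, rfl, fun s hs => Function.update_of_ne (this s hs) _ _⟩
    · exact ⟨rfl, rfl, fun s hs => Function.update_of_ne (this s hs) _ _⟩
    · exact ⟨rfl, rfl, fun _ _ => rfl⟩
  | enough e =>
    rw [receive_enough S e hx]
    split_ifs <;> exact ⟨rfl, rfl, fun _ _ => rfl⟩
  | value M => rw [receive_value S M hx]; exact ⟨rfl, rfl, fun _ _ => rfl⟩
  | report M => rw [receive_report S M hx]; exact ⟨rfl, rfl, fun _ _ => rfl⟩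

/-- Turns the order statistic into a count, which can be bounded by counting senders and is monotone
in `T`. For `c = ⊤` the default value of a short list would break the equivalence. -/
theorem nextSmallest_le_iff (t : ℕ) (T : Multiset EReal) {c : EReal} (hc : c ≠ ⊤) :
    nextSmallest t T ≤ c ↔ t < (T.filter (· ≤ c)).card := by
  have key : ∀ (l : List EReal) (t : ℕ), l.Pairwise (· ≤ ·) →
      (l.getD t ⊤ ≤ c ↔ t < (l.filter (· ≤ c)).length) := by
    intro l
    induction l with
    | nil => intro t _; simpa using hc
    | cons a l ih =>
      intro t hl
      obtain ⟨h1, h2⟩ := List.pairwise_cons.1 hl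
      by_cases hac : a ≤ c
      · rw [List.filter_cons_of_pos (by simpa using hac)]
        cases t with
        | zero => simpa using hac
        | succ t => simpa using ih t h2
      · rw [List.filter_cons_of_neg (by simpa using hac)]
        have hnil : l.filter (· ≤ c) = [] := by
          rw [List.filter_eq_nil_iff]
          intro b hb hbc
          exact hac ((h1 b hb).trans (by simpa using hbc))
        have h0 : ∀ t, ¬ l.getD t ⊤ ≤ c := fun t => by rw [ih t h2, hnil]; simp
        rw [hnil]
        cases t with
        | zero => simpa using hac
        | succ t => simpa using h0 t
  rw [nextSmallest, key _ t (Multiset.pairwise_sort T (· ≤ ·))]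
  conv_rhs => rw [← Multiset.sort_eq T (· ≤ ·)]
  rw [Multiset.filter_coe, Multiset.coe_card]

/-- Moves a count of message contents back to a count of messages, where senders and tags are
visible. -/
theorem card_filter_filterMap {α β : Type*} (f : α → Option β) (p : β → Prop) [DecidablePred p]
    (q : α → Prop) [DecidablePred q] (hq : ∀ a, q a ↔ ∃ b, f a = some b ∧ p b)
    (s : Multiset α) : ((s.filterMap f).filter p).card = (s.filter q).card := by
  induction s using Multiset.induction_on with
  | empty => simp
  | cons a s ih =>
    cases hf : f a with
    | none =>
      rw [Multiset.filterMap_cons_none _ _ hf, ih, Multiset.filter_cons_of_neg]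
      rw [hq, hf]; simp
    | some b =>
      rw [Multiset.filterMap_cons_some f _ _ hf]
      by_cases hb : p b
      · rw [Multiset.filter_cons_of_pos _ hb, Multiset.filter_cons_of_pos, Multiset.card_cons, ih,
          Multiset.card_cons]
        exact (hq a).2 ⟨b, hf, hb⟩
      · rw [Multiset.filter_cons_of_neg _ hb, Multiset.filter_cons_of_neg, ih]
        rw [hq, hf]
        rintro ⟨b', hb', hp⟩
        cases hb'
        exact hb hp

/-! ### Received messages in an execution; the bound on `halt`. -/

namespace Execution

variable {m : ℕ} {S : Setup m} {faulty : Finset (Fin S.n)} {input : Fin S.n → Point m}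
  (E : Execution S faulty input)

open scoped Classical in
/-- The broadcasts received by a node before its termination, with their senders. -/
noncomputable def received : ℕ → Fin S.n → Finset (Fin S.n × Msg m)
  | 0, _ => ∅
  | k + 1, i =>
    match E.event k with
    | .deliver i' j M =>
      if i' = i ∧ (E.state k i).phase ≠ .terminated then insert (j, M) (received k i)
      else received k i
    | _ => received k i

theorem mem_received {k : ℕ} {i j : Fin S.n} {M : Msg m} :
    (j, M) ∈ E.received k i ↔
      ∃ k' < k, E.event k' = .deliver i j M ∧ (E.state k' i).phase ≠ .terminated := by
  induction k with
  | zero => simp [received]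
  | succ k ih =>
    have hs : (∃ k' < k + 1, E.event k' = .deliver i j M ∧ (E.state k' i).phase ≠ .terminated) ↔
        (j, M) ∈ E.received k i ∨
          (E.event k = .deliver i j M ∧ (E.state k i).phase ≠ .terminated) := by
      rw [ih]
      constructor
      · rintro ⟨k', h1, h2⟩
        rcases (Nat.lt_succ_iff_lt_or_eq.1 h1) with h | rfl
        · exact .inl ⟨k', h, h2⟩
        · exact .inr h2
      · rintro (⟨k', h1, h2⟩ | h)
        · exact ⟨k', by omega, h2⟩
        · exact ⟨k, by omega, h⟩
    rw [hs, received]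
    split
    · rename_i i' j' M' he
      rw [he]
      split_ifs with hc
      · obtain ⟨rfl, hc⟩ := hc
        simp only [Finset.mem_insert, Prod.mk.injEq, Event.deliver.injEq, true_and]
        constructor
        · rintro (⟨rfl, rfl⟩ | h)
          · exact .inr ⟨⟨rfl, rfl⟩, hc⟩
          · exact .inl h
        · rintro (h | ⟨⟨rfl, rfl⟩, -⟩)
          · exact .inr h
          · exact .inl ⟨rfl, rfl⟩
      · simp only [Event.deliver.injEq]
        constructor
        · exact .inl
        · rintro (h | ⟨⟨rfl, -⟩, h⟩)
          · exact h
          · exact (hc ⟨rfl, h⟩).elim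
    · rename_i he
      constructor
      · exact .inl
      · rintro (h | ⟨h, -⟩)
        · exact h
        · exact (he _ _ _ h).elim

/-- What happens to a nonfaulty node at one moment. -/
theorem node_step {i : Fin S.n} (hi : i ∉ faulty) (k : ℕ) :
    (E.event k ≠ .act i ∧ E.state (k + 1) i = E.state k i ∧
      E.received (k + 1) i = E.received k i) ∨
    (∃ j M, E.event k = .deliver i j M ∧ (E.state k i).phase ≠ .terminated ∧
      E.state (k + 1) i = receive S M (E.state k i) ∧
      (E.received (k + 1) i).val = (j, M) ::ₘ (E.received k i).val) ∨
    (E.event k = .act i ∧ LocalStep S (E.state k i) (E.state (k + 1) i) ∧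
      E.received (k + 1) i = E.received k i) := by
  classical
  have hs := E.step k
  cases he : E.event k with
  | deliver i' j M =>
    rw [he] at hs
    by_cases hii : i' = i
    · subst hii
      by_cases hp : (E.state k i').phase = .terminated
      · refine .inl ⟨by simp, ?_, ?_⟩
        · rw [hs.2.1, receive_of_terminated S M hp]
        · rw [received, he]; simp [hp]
      · refine .inr (.inl ⟨j, M, rfl, hp, hs.2.1, ?_⟩)
        -- The rule `once` makes the insertion into the finset a genuine addition, matching the
        -- multiset the node accumulates.
        have hnot : (j, M) ∉ E.received k i' := by
          rw [mem_received]
          rintro ⟨k', hk', he', -⟩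
          exact hk'.ne (E.once _ _ _ _ _ he' he)
        have : E.received (k + 1) i' = insert (j, M) (E.received k i') := by
          rw [received, he]; simp [hp]
        rw [this, Finset.insert_val_of_notMem hnot]
    · refine .inl ⟨by simp, hs.2.2 i hi (Ne.symm hii), ?_⟩
      rw [received, he]; simp [hii]
  | act i' =>
    rw [he] at hs
    have hr : E.received (k + 1) i = E.received k i := by rw [received, he]
    by_cases hii : i' = i
    · subst hii
      exact .inr (.inr ⟨rfl, hs.2.1, hr⟩)
    · exact .inl ⟨by simpa using hii, hs.2.2 i hi (Ne.symm hii), hr⟩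
  | idle =>
    rw [he] at hs
    exact .inl ⟨by simp, hs i hi, by rw [received, he]⟩

/-- The multiset of messages received by a node before its termination. -/
noncomputable def messages (k : ℕ) (i : Fin S.n) : Multiset (Msg m) :=
  (E.received k i).val.map Prod.snd

theorem messages_mono {k k' : ℕ} {i j : Fin S.n} (h : E.received k i ⊆ E.received k' j) :
    E.messages k i ≤ E.messages k' j :=
  Multiset.map_le_map (Finset.val_le_iff.2 h)

theorem nodeInv (hn : 3 * S.t + 1 ≤ S.n) {i : Fin S.n} (hi : i ∉ faulty) (k : ℕ) :
    NodeInv S (input i) (E.messages k i) (E.state k i) := by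
  induction k with
  | zero =>
    rw [E.initially i hi]
    exact NodeInv.initial S (by omega) _
  | succ k ih =>
    rcases E.node_step hi k with ⟨-, h1, h2⟩ | ⟨j, M, -, hp, h1, h2⟩ | ⟨-, h1, h2⟩
    · rw [messages, h1, h2]; exact ih
    · rw [messages, h1, h2, Multiset.map_cons]
      exact ih.receive hp M
    · rw [messages, h2]
      exact ih.localStep hn h1

theorem grows (hn : 3 * S.t + 1 ≤ S.n) {i : Fin S.n} (hi : i ∉ faulty) {k k' : ℕ} (h : k ≤ k') :
    Grows (E.state k i) (E.state k' i) := by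
  induction k', h using Nat.le_induction with
  | base => exact .refl _
  | succ k' _ ih =>
    refine ih.trans ?_
    rcases E.node_step hi k' with ⟨-, h1, -⟩ | ⟨j, M, -, -, h1, -⟩ | ⟨-, h1, -⟩
    · rw [h1]; exact .refl _
    · rw [h1]; exact Grows.receive S M _
    · exact (E.nodeInv hn hi k').grows h1

theorem sent_of_mem_received (hn : 3 * S.t + 1 ≤ S.n) {i j : Fin S.n} (hj : j ∉ faulty)
    {k : ℕ} {M : Msg m} (h : (j, M) ∈ E.received k i) : M ∈ (E.state k j).sent := by
  obtain ⟨k', hk, he, -⟩ := E.mem_received.1 h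
  exact (E.grows hn hj hk.le).sent M (E.authentic _ _ _ _ he hj)

/-- Under a common tag the uniqueness rule lets the sender determine the message, so projecting to
senders is injective. -/
theorem card_le_of_same_tag {k : ℕ} {i : Fin S.n} {T : Finset (Fin S.n × Msg m)}
    (hT : T ⊆ E.received k i) {τ : MsgKind × ℕ} (hτ : ∀ q ∈ T, q.2.tag = τ)
    {F : Finset (Fin S.n)} (hF : ∀ q ∈ T, q.1 ∈ F) : T.card ≤ F.card := by
  refine Finset.card_le_card_of_injOn Prod.fst hF ?_
  rintro ⟨j, M⟩ hq ⟨j', M'⟩ hq' (rfl : j = j')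
  obtain ⟨k1, -, h1, -⟩ := E.mem_received.1 (hT hq)
  obtain ⟨k2, -, h2, -⟩ := E.mem_received.1 (hT hq')
  rw [E.unique _ _ _ _ _ _ _ h1 h2 ((hτ _ hq).trans (hτ _ hq').symm)]

/-- Received estimates above `c` come from faulty senders, one per sender, hence number at most `t`.
The remaining ones number at least `n - 2t ≥ t + 1`, so the `(t+1)`-th smallest is at most `c`. -/
theorem halt_le (hn : 3 * S.t + 1 ≤ S.n) (hfaulty : faulty.card ≤ S.t)
    {i : Fin S.n} (hi : i ∉ faulty) {c : EReal} (hc : c ≠ ⊤)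
    (hsent : ∀ j, j ∉ faulty → ∀ k e, Msg.enough e ∈ (E.state k j).sent → e ≤ c) {k : ℕ}
    (hk : S.n - S.t ≤ (E.state k i).terminationTimes.card) : (E.state k i).halt ≤ c := by
  classical
  have hinv := E.nodeInv hn hi k
  rw [hinv.halt hk, nextSmallest_le_iff _ _ hc]
  have hsplit := congrArg Multiset.card
    (Multiset.filter_add_not (fun e => e ≤ c) (E.state k i).terminationTimes)
  rw [Multiset.card_add] at hsplit
  have hbad : ((E.state k i).terminationTimes.filter (fun e => ¬ e ≤ c)).card ≤ S.t := by
    refine le_trans ?_ hfaulty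
    rw [hinv.times, card_filter_filterMap Msg.estimate? (fun e => ¬ e ≤ c)
      (fun M => ∃ e, Msg.estimate? M = some e ∧ ¬ e ≤ c) (fun _ => Iff.rfl), messages,
      Multiset.filter_map, Multiset.card_map]
    have hmem : ∀ q ∈ (E.received k i).filter
        (fun q => ∃ e, Msg.estimate? q.2 = some e ∧ ¬ e ≤ c),
        q ∈ E.received k i ∧ ∃ e, q.2 = .enough e ∧ ¬ e ≤ c := by
      rintro ⟨j, M⟩ hq
      obtain ⟨h1, e, h2, h3⟩ := Finset.mem_filter.1 hq
      refine ⟨h1, e, ?_, h3⟩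
      cases M <;> cases h2
      rfl
    refine E.card_le_of_same_tag (Finset.filter_subset
      (fun q : Fin S.n × Msg m => ∃ e, Msg.estimate? q.2 = some e ∧ ¬ e ≤ c) _)
      (τ := (.enough, 0)) ?_ ?_
    · intro q hq
      obtain ⟨-, e, h2, -⟩ := hmem q hq
      rw [h2]; rfl
    · rintro ⟨j, M⟩ hq
      obtain ⟨h1, e, h2, h3⟩ := hmem _ hq
      by_contra hj
      change M = _ at h2
      subst h2
      exact h3 (hsent j hj k e (E.sent_of_mem_received hn hj h1))
  omega

end Execution

/-! ### The bound on the number of rounds. -/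

/-- An upper bound for the estimates of the number of rounds from values of diameter at most `D`. -/
noncomputable def estimateBound (D ε : ℝ) : EReal :=
  if D = 0 then ⊥ else (((⌈Real.logb 2 (3 * D / ε)⌉ + 1 : ℤ) : ℝ) : EReal)

theorem estimateBound_ne_top (D ε : ℝ) : estimateBound D ε ≠ ⊤ := by
  unfold estimateBound
  split_ifs
  · simp
  · exact EReal.coe_ne_top _

/-- The estimate is monotone in the diameter. Boundedness matters because `Metric.diam` of an
unbounded set is `0`. -/
theorem enoughRounds_le_estimateBound {m : ℕ} {ε : ℝ} (hε : 0 < ε) {V : Set (Point m)}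
    (hV : Bornology.IsBounded V) {A : Multiset (Point m)} (hA : ∀ p ∈ A, p ∈ V) :
    enoughRounds ε A ≤ estimateBound (Metric.diam V) ε := by
  have hle : mdiam A ≤ Metric.diam V := Metric.diam_mono hA hV
  have h0 : 0 ≤ mdiam A := Metric.diam_nonneg
  unfold enoughRounds estimateBound
  split_ifs with h1 h2 h2
  · exact le_rfl
  · exact bot_le
  · exact (h1 (le_antisymm (h2 ▸ hle) h0)).elim
  · have hpos : 0 < mdiam A := lt_of_le_of_ne h0 (Ne.symm h1)
    rw [EReal.coe_le_coe_iff, Int.cast_le]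
    gcongr
    norm_num

/-- A strict inequality of integers leaves room for one more round. For `D = 0` the bound is `⊥` and
the loop test cannot succeed. -/
theorem add_one_le_roundBound {D ε : ℝ} {r : ℕ}
    (h : ((r : ℝ) : EReal) < estimateBound D ε) : (r : ℤ) + 1 ≤ roundBound D ε := by
  unfold estimateBound at h
  unfold roundBound
  split_ifs at h ⊢
  · exact (not_lt_bot h).elim
  · rw [EReal.coe_lt_coe_iff] at h
    refine le_trans ?_ (le_max_right _ _)
    have : (r : ℤ) < ⌈Real.logb 2 (3 * D / ε)⌉ + 1 := by exact_mod_cast h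
    omega

theorem one_le_roundBound (D ε : ℝ) : 1 ≤ roundBound D ε := by
  unfold roundBound
  split_ifs
  · exact le_rfl
  · exact le_max_left _ _

/-- The round of a node is at most `B`, and smaller in the loops that may increase it. -/
def RoundInv {m : ℕ} (B : ℤ) (x : NodeState m) : Prop :=
  (x.r : ℤ) ≤ B ∧
    (x.phase = .valueLoop → (x.r : ℤ) + 1 ≤ B) ∧
    (x.phase = .reportLoop → (x.r : ℤ) + 1 ≤ B ∨ x.values x.r = 0)

/-- The loop test supplies `r + 1 ≤ B`, the value loop keeps it, and the report loop spends it at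
most once. -/
theorem RoundInv.localStep {m : ℕ} {S : Setup m} (hpos : 0 < S.n - S.t) {v : Point m}
    {H : Multiset (Msg m)} {x y : NodeState m} (h : NodeInv S v H x) {B : ℤ} (hB : 1 ≤ B)
    (hhalt : S.n - S.t ≤ x.terminationTimes.card → ((x.r : ℝ) : EReal) < x.halt →
      (x.r : ℤ) + 1 ≤ B)
    (hx : RoundInv B x) (hxy : LocalStep S x y) : RoundInv B y := by
  classical
  cases hxy with
  | start hp => exact ⟨hx.1, fun h => (by cases h), fun h => (by cases h)⟩
  | initContinue hp => exact ⟨hx.1, fun h => (by cases h), fun h => (by cases h)⟩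
  | initReport M hp hM hM0 hMr =>
    unfold acceptInitReport
    dsimp only
    split_ifs
    · exact ⟨hx.1, fun h => (by cases hp.symm.trans h), fun h => (by cases hp.symm.trans h)⟩
    · exact ⟨hx.1, fun h => (by cases hp.symm.trans h), fun h => (by cases hp.symm.trans h)⟩
  | initLoopEnd hp => exact ⟨hx.1, fun h => (by cases h), fun h => (by cases h)⟩
  | initComplete hp ht hr => exact ⟨hB, fun h => (by cases h), fun h => (by cases h)⟩
  | mainContinue hp hh =>
    have := hhalt (h.main_round (by rw [hp]; trivial)).2 hh
    exact ⟨hx.1, fun _ => this, fun h => (by cases h)⟩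
  | value M hp hM hMr =>
    unfold acceptValue
    dsimp only
    split_ifs
    · exact ⟨hx.1, fun _ => hx.2.1 hp, fun h => (by cases hp.symm.trans h)⟩
    · exact ⟨hx.1, fun _ => hx.2.1 hp, fun h => (by cases hp.symm.trans h)⟩
  | valueLoopEnd hp => exact ⟨hx.1, fun h => (by cases h), fun _ => .inl (hx.2.1 hp)⟩
  | report M hp hM hMr =>
    unfold acceptReport
    dsimp only
    split_ifs with hc
    · have h1 : (x.r : ℤ) + 1 ≤ B := by
        -- A ready report of the current round contains at least `n - t > 0` of its values, so the
        -- round has not already been advanced in this loop.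
        refine (hx.2.2 hp).resolve_right fun h0 => ?_
        have := hMr.2.1.trans (Multiset.card_le_card (hc.1 ▸ hMr.2.2))
        rw [h0, Multiset.card_zero] at this
        omega
      refine ⟨?_, fun h => (by cases hp.symm.trans h), fun _ => .inr ?_⟩
      · change ((x.r + 1 : ℕ) : ℤ) ≤ B
        exact_mod_cast h1
      · exact h.future_values _ (Nat.lt_succ_self _)
    · exact ⟨hx.1, fun h => (by cases hp.symm.trans h), fun _ => hx.2.2 hp⟩
  | reportLoopEnd hp => exact ⟨hx.1, fun h => (by cases h), fun h => (by cases h)⟩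
  | terminate hp hh => exact ⟨hx.1, fun h => (by cases h), fun h => (by cases h)⟩

theorem Execution.round_le {m : ℕ} {S : Setup m} (hn : 3 * S.t + 1 ≤ S.n) (hε : 0 < S.ε)
    {faulty : Finset (Fin S.n)} (hfaulty : faulty.card ≤ S.t) {input : Fin S.n → Point m}
    (E : Execution S faulty input) {i : Fin S.n} (hi : i ∉ faulty)
    (hV : Bornology.IsBounded S.validInputs) (k : ℕ) :
    ((E.state k i).r : ℤ) ≤ roundBound (Metric.diam S.validInputs) S.ε := by
  have hpos : 0 < S.n - S.t := by omega
  suffices h : RoundInv (roundBound (Metric.diam S.validInputs) S.ε) (E.state k i) from h.1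
  induction k with
  | zero =>
    rw [E.initially i hi]
    exact ⟨zero_le_one.trans (one_le_roundBound _ _), fun h => (by cases h), fun h => (by cases h)⟩
  | succ k ih =>
    rcases E.node_step hi k with ⟨-, h1, -⟩ | ⟨j, M, -, -, h1, -⟩ | ⟨-, h1, -⟩
    · rw [h1]; exact ih
    · obtain ⟨f1, f2, f3⟩ := receive_frame S M (E.state k i)
      have hinv := E.nodeInv hn hi k
      rw [h1]
      unfold RoundInv
      rw [f1, f2]
      refine ⟨ih.1, ih.2.1, fun hp => ?_⟩
      -- Receptions change values only in round `0`, and here `r ≥ 1`.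
      rw [f3 _ (hinv.main_round (by rw [hp]; trivial)).1]
      exact ih.2.2 hp
    · refine ih.localStep hpos (E.nodeInv hn hi k) (one_le_roundBound _ _) (fun hc hr => ?_) h1
      refine add_one_le_roundBound (hr.trans_le ?_)
      refine E.halt_le hn hfaulty hi (estimateBound_ne_top _ _) (fun j hj k e he => ?_) hc
      obtain ⟨A, rfl, hA⟩ := (E.nodeInv hn hj k).sent_enough e he
      exact enoughRounds_le_estimateBound hε hV hA

/-- With `L = log₂ (D/ε) ≥ 1` and `log₂ 3 ≤ 2`, the ceiling is below `L + 3`, so the bound is below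
`L + 4 ≤ 5L`. -/
theorem roundBound_le_log {D ε : ℝ} (hε : 0 < ε) (hD : 2 * ε ≤ D) :
    (roundBound D ε : ℝ) ≤ 5 * Real.logb 2 (D / ε) := by
  have hD0 : 0 < D := by linarith
  have h1 : 1 ≤ Real.logb 2 (D / ε) := by
    rw [Real.le_logb_iff_rpow_le (by norm_num) (by positivity), Real.rpow_one, le_div_iff₀ hε]
    exact hD
  have h3 : Real.logb 2 (3 * D / ε) ≤ 2 + Real.logb 2 (D / ε) := by
    rw [mul_div_assoc, Real.logb_mul (by norm_num) (by positivity)]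
    gcongr
    rw [Real.logb_le_iff_le_rpow (by norm_num) (by norm_num)]
    norm_num
  unfold roundBound
  rw [if_neg hD0.ne', Int.cast_max, max_le_iff]
  constructor
  · push_cast; linarith
  · push_cast
    have := Int.ceil_lt_add_one (Real.logb 2 (3 * D / ε))
    linarith

/-! ### Every for loop ends; recurring visits to the loop exits. -/

open Filter

/-- Accepting a message keeps the phase, so a change of phase reveals the guard of the transition: a
loop test, or the absence of ready waiting messages. -/
theorem LocalStep.exit {m : ℕ} {S : Setup m} {x y : NodeState m} (h : LocalStep S x y)
    (hp : y.phase ≠ x.phase) :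
    (x.phase = .start → y.phase = .initHead) ∧
    (x.phase = .initHead → y.phase = .mainHead ∨ y.phase = .initLoop ∧
      (x.terminationTimes.card < S.n - S.t ∨ (x.reports 0).card < S.n - S.t)) ∧
    (x.phase = .initLoop → y.phase = .initHead ∧
      ∀ M ∈ x.waitingReports, M.round = 0 → ¬ reportReady S x M) ∧
    (x.phase = .mainHead → y.phase = .terminated ∨ y.phase = .valueLoop ∧
      ((x.r : ℝ) : EReal) < x.halt) ∧
    (x.phase = .valueLoop → y.phase = .reportLoop ∧ ∀ M ∈ x.waitingValues, ¬ valueReady S x M) ∧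
    (x.phase = .reportLoop → y.phase = .mainHead ∧
      ∀ M ∈ x.waitingReports, ¬ reportReady S x M) := by
  cases h with
  | start hx => simp [hx, NodeState.goto]
  | initContinue hx hc => simpa [hx, NodeState.goto] using hc
  | initReport M hx =>
    refine (hp ?_).elim
    unfold acceptInitReport
    dsimp only
    split_ifs <;> rfl
  | initLoopEnd hx hc => simpa [hx, NodeState.goto] using hc
  | initComplete hx => simp [hx, NodeState.goto]
  | mainContinue hx hc => simpa [hx, NodeState.goto] using hc
  | value M hx =>
    refine (hp ?_).elim
    unfold acceptValue
    dsimp only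
    split_ifs <;> rfl
  | valueLoopEnd hx hc => simpa [hx, NodeState.goto] using hc
  | report M hx =>
    refine (hp ?_).elim
    unfold acceptReport
    dsimp only
    split_ifs <;> rfl
  | reportLoopEnd hx hc => simpa [hx, NodeState.goto] using hc
  | terminate hx => simp [hx, NodeState.goto]

/-- A step that keeps the phase accepts a message, of a round at most `R`. In the value loop `r` is
fixed. In the report loop `r` may grow, but rounds beyond `R` have no values, so none of their
reports is ready. -/
theorem LocalStep.stay {m : ℕ} {S : Setup m} (hpos : 0 < S.n - S.t) {x y : NodeState m}
    (h : LocalStep S x y) (hp : y.phase = x.phase) {R : ℕ}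
    (hv : x.phase = .valueLoop → x.r = R)
    (hr : x.phase = .reportLoop → ∀ s, R < s → x.values s = 0) :
    (x.phase = .valueLoop → y.r = R) ∧
    (x.phase = .reportLoop → ∀ s, R < s → y.values s = 0) ∧
    ∃ s ≤ R, (x.values s).card + (x.reports s).card < (y.values s).card + (y.reports s).card := by
  classical
  cases h with
  | start hx => rw [hx] at hp; cases hp
  | initContinue hx hc => rw [hx] at hp; cases hp
  | initReport M hx =>
    refine ⟨fun h => (by cases hx.symm.trans h), fun h => (by cases hx.symm.trans h), 0,
      Nat.zero_le _, ?_⟩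
    unfold acceptInitReport
    dsimp only
    split_ifs <;> simp [NodeState.broadcast, NodeState.addToReports]
  | initLoopEnd hx hc => rw [hx] at hp; cases hp
  | initComplete hx => rw [hx] at hp; cases hp
  | mainContinue hx hc => rw [hx] at hp; cases hp
  | value M hx hM hMr =>
    have hR := hv hx
    refine ⟨fun _ => ?_, fun h => (by cases hx.symm.trans h), M.round, hR ▸ hMr.1, ?_⟩
    · rw [← hR]
      unfold acceptValue
      dsimp only
      split_ifs <;> rfl
    · unfold acceptValue
      dsimp only
      split_ifs <;> simp [NodeState.broadcast, NodeState.addToValues]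
  | valueLoopEnd hx hc => rw [hx] at hp; cases hp
  | report M hx hM hMr =>
    have hR := hr hx
    refine ⟨fun h => (by cases hx.symm.trans h), fun _ s hs => ?_, M.round, ?_, ?_⟩
    · rw [← hR s hs]
      unfold acceptReport
      dsimp only
      split_ifs <;> rfl
    · by_contra hlt
      have := hMr.2.1.trans (Multiset.card_le_card hMr.2.2)
      rw [hR _ (not_le.1 hlt), Multiset.card_zero] at this
      omega
    · unfold acceptReport
      dsimp only
      split_ifs <;> simp [broadcastVote, NodeState.broadcast, NodeState.addToReports]
  | reportLoopEnd hx hc => rw [hx] at hp; cases hp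
  | terminate hx => rw [hx] at hp; cases hp

namespace Execution

variable {m : ℕ} {S : Setup m} {faulty : Finset (Fin S.n)} {input : Fin S.n → Point m}
  (E : Execution S faulty input)

theorem card_filter_messages_le {β : Type*} (f : Msg m → Option β) (p : β → Prop)
    [DecidablePred p] {τ : MsgKind × ℕ} (hτ : ∀ M b, f M = some b → p b → M.tag = τ)
    (k : ℕ) (i : Fin S.n) : (((E.messages k i).filterMap f).filter p).card ≤ S.n := by
  classical
  rw [card_filter_filterMap f p (fun M => ∃ b, f M = some b ∧ p b) (fun _ => Iff.rfl), messages,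
    Multiset.filter_map, Multiset.card_map]
  refine (E.card_le_of_same_tag (T := (E.received k i).filter
    (fun q : Fin S.n × Msg m => ∃ b, f q.2 = some b ∧ p b)) (Finset.filter_subset _ _)
    (τ := τ) ?_ (F := Finset.univ) (fun _ _ => Finset.mem_univ _)).trans (by simp)
  intro q hq
  obtain ⟨-, b, h1, h2⟩ := Finset.mem_filter.1 hq
  exact hτ _ b h1 h2

theorem card_values_le (hn : 3 * S.t + 1 ≤ S.n) {i : Fin S.n} (hi : i ∉ faulty) (k s : ℕ) :
    ((E.state k i).values s).card ≤ S.n := by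
  have hinv := E.nodeInv hn hi k
  rcases Nat.eq_zero_or_pos s with rfl | hs
  · rw [hinv.values_zero]
    have := E.card_filter_messages_le (Msg.validInput? S) (fun _ => True) (τ := (.initValue, 0))
      (fun M b h _ => by cases M <;> first | rfl | cases h) k i
    rwa [Multiset.filter_eq_self.2 (fun _ _ => trivial)] at this
  · obtain ⟨a, h1, h2, -⟩ := hinv.accepted_values
    rw [h2 s hs, Multiset.card_map]
    refine le_trans (Multiset.card_le_card ?_)
      (E.card_filter_messages_le Msg.value? (fun M => M.round = s) (τ := (.value, s))
        (fun M b h hb => by cases M <;> cases h; rw [← hb]; rfl) k i)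
    rw [h1]
    exact Multiset.filter_le_filter _ (Multiset.le_add_left _ _)

theorem card_reports_le (hn : 3 * S.t + 1 ≤ S.n) {i : Fin S.n} (hi : i ∉ faulty) (k s : ℕ) :
    ((E.state k i).reports s).card ≤ S.n := by
  have hinv := E.nodeInv hn hi k
  obtain ⟨a, h1, h2, -⟩ := hinv.accepted_reports
  rw [h2 s, Multiset.card_map]
  refine le_trans (Multiset.card_le_card ?_)
    (E.card_filter_messages_le Msg.report? (fun M => M.round = s) (τ := (.report, s))
      (fun M b h hb => by cases M <;> cases h; rw [← hb]; rfl) k i)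
  rw [h1]
  exact Multiset.filter_le_filter _ (Multiset.le_add_left _ _)

/-- A nonfaulty node that never terminates. -/
structure Runs (i : Fin S.n) : Prop where
  nonfaulty : i ∉ faulty
  phase : ∀ k, (E.state k i).phase ≠ .terminated

variable {E}

/-- A node that does not terminate leaves its current phase: every for loop ends. -/
theorem Runs.leaves (hn : 3 * S.t + 1 ≤ S.n) (hE : E.Fair) {i : Fin S.n} (hi : E.Runs i) (k : ℕ) :
    ∃ k' ≥ k, (E.state k' i).phase = (E.state k i).phase ∧
      (E.state (k' + 1) i).phase ≠ (E.state k' i).phase ∧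
      LocalStep S (E.state k' i) (E.state (k' + 1) i) := by
  by_contra! hcon
  have hpos : 0 < S.n - S.t := by omega
  set R := (E.state k i).r with hR
  have key : ∀ k' ≥ k, (E.state k' i).phase = (E.state k i).phase ∧
      ((E.state k' i).phase = .valueLoop → (E.state k' i).r = R) ∧
      ((E.state k' i).phase = .reportLoop → ∀ s, R < s → (E.state k' i).values s = 0) := by
    intro k' hk'
    induction k', hk' using Nat.le_induction with
    | base => exact ⟨rfl, fun _ => hR.symm, fun _ => (E.nodeInv hn hi.nonfaulty k).future_values⟩
    | succ k' hk' ih =>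
      obtain ⟨h1, h2, h3⟩ := ih
      rcases E.node_step hi.nonfaulty k' with ⟨-, hs, -⟩ | ⟨j, M, -, -, hs, -⟩ | ⟨-, hs, -⟩
      · rw [hs]; exact ⟨h1, h2, h3⟩
      · obtain ⟨f1, f2, f3⟩ := receive_frame S M (E.state k' i)
        rw [hs, f1, f2]
        exact ⟨h1, h2, fun hp s hs => (f3 s (by omega)).trans (h3 hp s hs)⟩
      · have hph : (E.state (k' + 1) i).phase = (E.state k' i).phase := by
          by_contra hne
          exact hcon k' hk' h1 hne hs
        obtain ⟨g1, g2, -⟩ := hs.stay hpos hph h2 h3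
        rw [hph]
        exact ⟨h1, g1, g2⟩
  -- If the phase never changed, every step of the node would increase this count of accepted values
  -- and reports, which is at most `2n` per round.
  let f : ℕ → ℕ := fun k' => ∑ s ∈ Finset.range (R + 1),
    (((E.state k' i).values s).card + ((E.state k' i).reports s).card)
  have hmono : Monotone f := fun a b hab => Finset.sum_le_sum fun s _ => by
    have g := E.grows hn hi.nonfaulty hab
    exact Nat.add_le_add (Multiset.card_le_card (g.values s)) (Multiset.card_le_card (g.reports s))
  have hunb : ∀ N, ∃ k' ≥ k, N ≤ f k' := by
    intro N
    induction N with
    | zero => exact ⟨k, le_rfl, Nat.zero_le _⟩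
    | succ N ih =>
      obtain ⟨k1, hk1, hN⟩ := ih
      obtain ⟨k2, hk2, hact⟩ := hE.progress k1 i hi.nonfaulty
      have hact := hact.resolve_right (hi.phase k2)
      refine ⟨k2 + 1, by omega, ?_⟩
      have hk : k2 ≥ k := hk1.trans hk2
      have hs : LocalStep S (E.state k2 i) (E.state (k2 + 1) i) := by
        rcases E.node_step hi.nonfaulty k2 with ⟨hne, -⟩ | ⟨j, M, hd, -⟩ | ⟨-, hs, -⟩
        · exact (hne hact).elim
        · rw [hact] at hd; cases hd
        · exact hs
      obtain ⟨h1, h2, h3⟩ := key k2 hk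
      have hph : (E.state (k2 + 1) i).phase = (E.state k2 i).phase :=
        (key (k2 + 1) (by omega)).1.trans h1.symm
      obtain ⟨-, -, s, hsR, hlt⟩ := hs.stay hpos hph h2 h3
      have hlt' : f k2 < f (k2 + 1) := by
        refine Finset.sum_lt_sum (fun s _ => ?_) ⟨s, Finset.mem_range.2 (by omega), hlt⟩
        have g := E.grows hn hi.nonfaulty (Nat.le_succ k2)
        exact Nat.add_le_add (Multiset.card_le_card (g.values s))
          (Multiset.card_le_card (g.reports s))
      have := hmono hk2
      omega
  obtain ⟨k', -, hk'⟩ := hunb ((R + 1) * (S.n + S.n) + 1)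
  have hle : f k' ≤ (R + 1) * (S.n + S.n) := by
    refine (Finset.sum_le_card_nsmul _ _ (S.n + S.n) fun s _ => ?_).trans (by simp)
    exact Nat.add_le_add (E.card_values_le hn hi.nonfaulty k' s)
      (E.card_reports_le hn hi.nonfaulty k' s)
  omega

theorem isMain_iff (hn : 3 * S.t + 1 ≤ S.n) {i : Fin S.n} (hi : i ∉ faulty) (k : ℕ) :
    (E.state k i).phase.IsMain ↔ 1 ≤ (E.state k i).r := by
  have hinv := E.nodeInv hn hi k
  refine ⟨fun h => (hinv.main_round h).1, fun h => ?_⟩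
  by_contra hc
  have := hinv.init_round hc
  omega

theorem Runs.start_exit (hn : 3 * S.t + 1 ≤ S.n) (hE : E.Fair) {i : Fin S.n} (hi : E.Runs i)
    {k : ℕ} (hk : (E.state k i).phase = .start) : ∃ k' ≥ k, (E.state k' i).phase = .initHead := by
  obtain ⟨k', h1, h2, h3, h4⟩ := hi.leaves hn hE k
  exact ⟨k' + 1, by omega, (h4.exit h3).1 (h2.trans hk)⟩

theorem Runs.initHead_exit (hn : 3 * S.t + 1 ≤ S.n) (hE : E.Fair) {i : Fin S.n} (hi : E.Runs i)
    {k : ℕ} (hk : (E.state k i).phase = .initHead) :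
    ∃ k' ≥ k, (E.state (k' + 1) i).phase = .mainHead ∨ (E.state (k' + 1) i).phase = .initLoop ∧
      ((E.state k' i).terminationTimes.card < S.n - S.t ∨
        ((E.state k' i).reports 0).card < S.n - S.t) := by
  obtain ⟨k', h1, h2, h3, h4⟩ := hi.leaves hn hE k
  exact ⟨k', h1, (h4.exit h3).2.1 (h2.trans hk)⟩

theorem Runs.initLoop_exit (hn : 3 * S.t + 1 ≤ S.n) (hE : E.Fair) {i : Fin S.n} (hi : E.Runs i)
    {k : ℕ} (hk : (E.state k i).phase = .initLoop) :
    ∃ k' ≥ k, (E.state (k' + 1) i).phase = .initHead ∧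
      ∀ M ∈ (E.state k' i).waitingReports, M.round = 0 → ¬ reportReady S (E.state k' i) M := by
  obtain ⟨k', h1, h2, h3, h4⟩ := hi.leaves hn hE k
  exact ⟨k', h1, (h4.exit h3).2.2.1 (h2.trans hk)⟩

theorem Runs.mainHead_exit (hn : 3 * S.t + 1 ≤ S.n) (hE : E.Fair) {i : Fin S.n} (hi : E.Runs i)
    {k : ℕ} (hk : (E.state k i).phase = .mainHead) :
    ∃ k' ≥ k, (E.state (k' + 1) i).phase = .valueLoop ∧
      (((E.state k' i).r : ℝ) : EReal) < (E.state k' i).halt := by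
  obtain ⟨k', h1, h2, h3, h4⟩ := hi.leaves hn hE k
  exact ⟨k', h1, ((h4.exit h3).2.2.2.1 (h2.trans hk)).resolve_left (hi.phase _)⟩

theorem Runs.valueLoop_exit (hn : 3 * S.t + 1 ≤ S.n) (hE : E.Fair) {i : Fin S.n} (hi : E.Runs i)
    {k : ℕ} (hk : (E.state k i).phase = .valueLoop) :
    ∃ k' ≥ k, (E.state (k' + 1) i).phase = .reportLoop ∧
      ∀ M ∈ (E.state k' i).waitingValues, ¬ valueReady S (E.state k' i) M := by
  obtain ⟨k', h1, h2, h3, h4⟩ := hi.leaves hn hE k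
  exact ⟨k', h1, (h4.exit h3).2.2.2.2.1 (h2.trans hk)⟩

theorem Runs.reportLoop_exit (hn : 3 * S.t + 1 ≤ S.n) (hE : E.Fair) {i : Fin S.n} (hi : E.Runs i)
    {k : ℕ} (hk : (E.state k i).phase = .reportLoop) :
    ∃ k' ≥ k, (E.state (k' + 1) i).phase = .mainHead ∧
      ∀ M ∈ (E.state k' i).waitingReports, ¬ reportReady S (E.state k' i) M := by
  obtain ⟨k', h1, h2, h3, h4⟩ := hi.leaves hn hE k
  exact ⟨k', h1, (h4.exit h3).2.2.2.2.2 (h2.trans hk)⟩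

theorem Runs.exists_mainHead (hn : 3 * S.t + 1 ≤ S.n) (hE : E.Fair) {i : Fin S.n}
    (hi : E.Runs i) {k : ℕ} (hk : 1 ≤ (E.state k i).r) :
    ∃ k' ≥ k, (E.state k' i).phase = .mainHead := by
  have hm := (isMain_iff hn hi.nonfaulty k).2 hk
  have hrl : ∀ {k}, (E.state k i).phase = .reportLoop →
      ∃ k' ≥ k, (E.state k' i).phase = .mainHead := fun hp => by
    obtain ⟨k', h1, h2, -⟩ := hi.reportLoop_exit hn hE hp
    exact ⟨k' + 1, by omega, h2⟩
  cases hp : (E.state k i).phase with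
  | mainHead => exact ⟨k, le_rfl, hp⟩
  | valueLoop =>
    obtain ⟨k1, h1, h2, -⟩ := hi.valueLoop_exit hn hE hp
    obtain ⟨k2, h3, h4⟩ := hrl h2
    exact ⟨k2, by omega, h4⟩
  | reportLoop => exact hrl hp
  | terminated => exact (hi.phase k hp).elim
  | start => rw [hp] at hm; exact hm.elim
  | initHead => rw [hp] at hm; exact hm.elim
  | initLoop => rw [hp] at hm; exact hm.elim

/-- After any moment the loop test succeeds again and both for loops run dry again. When a loop is
dry, a received message that is ready must have been accepted. -/
theorem Runs.main_visits (hn : 3 * S.t + 1 ≤ S.n) (hE : E.Fair) {i : Fin S.n}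
    (hi : E.Runs i) {k : ℕ} (hk : 1 ≤ (E.state k i).r) :
    (∃ k' ≥ k, (((E.state k' i).r : ℝ) : EReal) < (E.state k' i).halt) ∧
    (∃ k' ≥ k, ∀ M ∈ (E.state k' i).waitingValues, ¬ valueReady S (E.state k' i) M) ∧
    (∃ k' ≥ k, ∀ M ∈ (E.state k' i).waitingReports, ¬ reportReady S (E.state k' i) M) := by
  obtain ⟨k0, h0, hp0⟩ := hi.exists_mainHead hn hE hk
  obtain ⟨k1, h1, hp1, hh⟩ := hi.mainHead_exit hn hE hp0
  obtain ⟨k2, h2, hp2, hv⟩ := hi.valueLoop_exit hn hE hp1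
  obtain ⟨k3, h3, -, hr⟩ := hi.reportLoop_exit hn hE hp2
  exact ⟨⟨k1, by omega, hh⟩, ⟨k2, by omega, hv⟩, ⟨k3, by omega, hr⟩⟩

/-- The condition that the phase at time `k` was not `initHead` excludes this alternative at a
second application, so two applications reach `initLoop` or round `1`. -/
theorem Runs.init_visits (hn : 3 * S.t + 1 ≤ S.n) (hE : E.Fair) {i : Fin S.n}
    (hi : E.Runs i) (k : ℕ) :
    ∃ k' ≥ k, 1 ≤ (E.state k' i).r ∨
      ((E.state k' i).phase = .initHead ∧ (E.state k i).phase ≠ .initHead) ∨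
      ((E.state k' i).phase = .initLoop ∧
        ∃ k'' ≥ k, (E.state k'' i).terminationTimes.card < S.n - S.t ∨
          ((E.state k'' i).reports 0).card < S.n - S.t) := by
  by_cases hm : 1 ≤ (E.state k i).r
  · exact ⟨k, le_rfl, .inl hm⟩
  have hm' := fun h => hm ((isMain_iff hn hi.nonfaulty k).1 h)
  cases hp : (E.state k i).phase with
  | start =>
    obtain ⟨k', h1, h2⟩ := hi.start_exit hn hE hp
    exact ⟨k', h1, .inr (.inl ⟨h2, by simp⟩)⟩
  | initHead =>
    obtain ⟨k', h1, h2⟩ := hi.initHead_exit hn hE hp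
    refine ⟨k' + 1, by omega, ?_⟩
    rcases h2 with h2 | ⟨h2, h3⟩
    · exact .inl ((isMain_iff hn hi.nonfaulty _).1 (by rw [h2]; trivial))
    · exact .inr (.inr ⟨h2, k', h1, h3⟩)
  | initLoop =>
    obtain ⟨k', h1, h2, -⟩ := hi.initLoop_exit hn hE hp
    exact ⟨k' + 1, by omega, .inr (.inl ⟨h2, by simp⟩)⟩
  | _ => rw [hp] at hm'; exact (hm' trivial).elim

theorem Runs.exists_initLoop (hn : 3 * S.t + 1 ≤ S.n) (hE : E.Fair) {i : Fin S.n}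
    (hi : E.Runs i) (k : ℕ) :
    ∃ k' ≥ k, 1 ≤ (E.state k' i).r ∨
      ((E.state k' i).phase = .initLoop ∧
        ∃ k'' ≥ k, (E.state k'' i).terminationTimes.card < S.n - S.t ∨
          ((E.state k'' i).reports 0).card < S.n - S.t) := by
  obtain ⟨k1, h1, h | ⟨h, -⟩ | h⟩ := hi.init_visits hn hE k
  · exact ⟨k1, h1, .inl h⟩
  · obtain ⟨k2, h2, h' | ⟨-, h'⟩ | ⟨h', k3, h3, h4⟩⟩ := hi.init_visits hn hE k1
    · exact ⟨k2, by omega, .inl h'⟩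
    · exact (h' h).elim
    · exact ⟨k2, by omega, .inr ⟨h', k3, by omega, h4⟩⟩
  · exact ⟨k1, h1, .inr h⟩

/-- Again and again, no report of round `s` that passes the check is waiting. -/
theorem Runs.report_visits (hn : 3 * S.t + 1 ≤ S.n) (hE : E.Fair) {i : Fin S.n}
    (hi : E.Runs i) {s k0 : ℕ} (hs : s ≤ (E.state k0 i).r) (k : ℕ) :
    ∃ k' ≥ k, ∀ M ∈ (E.state k' i).waitingReports, M.round = s →
      ¬ reportReady S (E.state k' i) M := by
  have hmain : ∀ k, 1 ≤ (E.state k i).r → ∃ k' ≥ k, ∀ M ∈ (E.state k' i).waitingReports,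
      M.round = s → ¬ reportReady S (E.state k' i) M := fun k hk => by
    obtain ⟨k', h1, h2⟩ := (hi.main_visits hn hE hk).2.2
    exact ⟨k', h1, fun M hM _ => h2 M hM⟩
  rcases Nat.eq_zero_or_pos s with rfl | hs0
  · obtain ⟨k1, h1, h | ⟨h, -⟩⟩ := hi.exists_initLoop hn hE k
    · obtain ⟨k2, h2, h3⟩ := hmain k1 h
      exact ⟨k2, by omega, h3⟩
    · obtain ⟨k2, h2, -, h3⟩ := hi.initLoop_exit hn hE h
      exact ⟨k2, by omega, h3⟩
  · obtain ⟨k', h1, h2⟩ := hmain (max k k0)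
      (Nat.succ_le_of_lt (hs0.trans_le (hs.trans (E.grows hn hi.nonfaulty (le_max_right k k0)).r)))
    exact ⟨k', le_trans (le_max_left _ _) h1, h2⟩

/-! ### What a running node eventually receives and accepts. -/

theorem Runs.eventually_received {i : Fin S.n} (hi : E.Runs i) {j : Fin S.n}
    {M : Msg m} (h : ∃ k, E.event k = .deliver i j M) :
    ∀ᶠ k in atTop, (j, M) ∈ E.received k i := by
  obtain ⟨k, hk⟩ := h
  filter_upwards [eventually_gt_atTop k] with k' hk'
  exact E.mem_received.2 ⟨k, hk', hk, hi.phase k⟩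

theorem Runs.eventually_received_subset (hE : E.Fair) {i j : Fin S.n} (hi : E.Runs i) (k : ℕ) :
    ∀ᶠ k' in atTop, E.received k j ⊆ E.received k' i := by
  have h : ∀ q ∈ E.received k j, ∀ᶠ k' in atTop, q ∈ E.received k' i := by
    rintro ⟨p, M⟩ hq
    obtain ⟨k', -, he, -⟩ := E.mem_received.1 hq
    exact hi.eventually_received (hE.totality _ _ i _ _ hi.nonfaulty he)
  exact (eventually_all_finset _).2 h

/-- The messages that the nonfaulty nodes send are eventually received. -/
theorem Runs.eventually_map_le {β : Type*} (hE : E.Fair) {i : Fin S.n}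
    (hi : E.Runs i) (f : Msg m → Option β) (b : Fin S.n → β)
    (h : ∀ j, j ∉ faulty → ∃ k M, f M = some (b j) ∧ M ∈ (E.state k j).sent) :
    ∀ᶠ k in atTop, (faultyᶜ).val.map b ≤ (E.messages k i).filterMap f := by
  classical
  have hcongr : ∀ (s : Multiset (Fin S.n)) (g : Fin S.n → Msg m),
      (∀ j ∈ s, f (g j) = some (b j)) → s.map b = (s.map g).filterMap f := by
    intro s g
    induction s using Multiset.induction_on with
    | empty => simp
    | cons a s ih =>
      intro hs
      rw [Multiset.map_cons, Multiset.map_cons,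
        Multiset.filterMap_cons_some f _ _ (hs a (Multiset.mem_cons_self _ _)),
        ih fun j hj => hs j (Multiset.mem_cons_of_mem hj)]
  have h' : ∀ j, ∃ M, j ∉ faulty → f M = some (b j) ∧ ∃ k, M ∈ (E.state k j).sent := by
    intro j
    by_cases hj : j ∈ faulty
    · exact ⟨.enough ⊤, fun h => (h hj).elim⟩
    · obtain ⟨k, M, h1, h2⟩ := h j hj
      exact ⟨M, fun _ => ⟨h1, k, h2⟩⟩
  choose g hg using h'
  have hrec : ∀ j ∈ faultyᶜ, ∀ᶠ k in atTop, (j, g j) ∈ E.received k i := by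
    intro j hj
    rw [Finset.mem_compl] at hj
    obtain ⟨-, k, hk⟩ := hg j hj
    exact hi.eventually_received (hE.delivery k i j _ hi.nonfaulty hj hk)
  filter_upwards [(eventually_all_finset _).2 hrec] with k hk
  rw [hcongr _ g fun j hj => (hg j (Finset.mem_compl.1 hj)).1]
  refine Multiset.filterMap_le_filterMap f ?_
  -- Equal contents from different senders must be counted separately; paired with their senders
  -- they are distinct, so membership suffices.
  have hle : (faultyᶜ).val.map (fun j => (j, g j)) ≤ (E.received k i).val := by
    rw [Multiset.le_iff_subset (Multiset.Nodup.map (fun a b hab => congrArg Prod.fst hab)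
      (Finset.nodup _))]
    intro q hq
    obtain ⟨j, hj, rfl⟩ := Multiset.mem_map.1 hq
    exact hk j hj
  have := Multiset.map_le_map (f := Prod.snd) hle
  rwa [Multiset.map_map] at this

theorem le_card_map_compl (hfaulty : faulty.card ≤ S.t) {β : Type*} (b : Fin S.n → β) :
    S.n - S.t ≤ ((faultyᶜ).val.map b).card := by
  rw [Multiset.card_map, Finset.card_val, Finset.card_compl, Fintype.card_fin]
  omega

/-- Applied with `W` the waiting and `a` the accepted messages: received messages that are no longer
waiting were accepted, with multiplicity. -/
theorem le_of_le_add_of_disjoint {α : Type*} {X W a : Multiset α} (h : X ≤ W + a)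
    (hd : ∀ x ∈ X, x ∉ W) : X ≤ a := by
  classical
  rw [Multiset.le_iff_count] at h ⊢
  intro x
  by_cases hx : x ∈ X
  · have := h x
    rwa [Multiset.count_add, Multiset.count_eq_zero_of_notMem (hd x hx), zero_add] at this
  · rw [Multiset.count_eq_zero_of_notMem hx]; exact Nat.zero_le _

theorem eventually_forall_mem {α : Type*} {X : Multiset α} {p : ℕ → α → Prop}
    (h : ∀ x ∈ X, ∀ᶠ k in atTop, p k x) : ∀ᶠ k in atTop, ∀ x ∈ X, p k x := by
  classical
  have := (eventually_all_finset (l := atTop) (p := fun x k => p k x) X.toFinset).2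
    (fun x hx => h x (Multiset.mem_toFinset.1 hx))
  filter_upwards [this] with k hk x hx using hk x (Multiset.mem_toFinset.2 hx)

/-- Once all of `X` is received and ready, the next moment at which the value loop is dry shows that
none of `X` is still waiting. -/
theorem Runs.eventually_values (hn : 3 * S.t + 1 ≤ S.n) (hE : E.Fair) {i : Fin S.n}
    (hi : E.Runs i) {s k0 : ℕ} (hs1 : 1 ≤ s) (hs : s ≤ (E.state k0 i).r)
    {X : Multiset (ValueMsg m)} (hX : ∀ M ∈ X, M.round = s)
    (hrec : ∀ᶠ k in atTop, X ≤ (E.messages k i).filterMap Msg.value?)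
    (hready : ∀ M ∈ X, ∀ᶠ k in atTop, valueReady S (E.state k i) M) :
    ∀ᶠ k in atTop, X.map ValueMsg.point ≤ (E.state k i).values s := by
  obtain ⟨K, hK⟩ := eventually_atTop.1 (hrec.and (eventually_forall_mem hready))
  obtain ⟨k1, h1, h2⟩ := (hi.main_visits hn hE (k := max K k0)
    (hs1.trans (hs.trans (E.grows hn hi.nonfaulty (le_max_right K k0)).r))).2.1
  obtain ⟨h3, h4⟩ := hK k1 (le_trans (le_max_left _ _) h1)
  obtain ⟨a, ha1, ha2, -⟩ := (E.nodeInv hn hi.nonfaulty k1).accepted_values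
  rw [ha1] at h3
  have hle := le_of_le_add_of_disjoint h3 fun M hM hw => h2 M hw (h4 M hM)
  filter_upwards [eventually_ge_atTop k1] with k hk
  refine le_trans ?_ ((E.grows hn hi.nonfaulty hk).values s)
  rw [ha2 s hs1]
  exact Multiset.map_le_map (Multiset.le_filter.2 ⟨hle, hX⟩)

theorem Runs.eventually_reports (hn : 3 * S.t + 1 ≤ S.n) (hE : E.Fair) {i : Fin S.n}
    (hi : E.Runs i) {s k0 : ℕ} (hs : s ≤ (E.state k0 i).r)
    {X : Multiset (ReportMsg m)} (hX : ∀ M ∈ X, M.round = s)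
    (hrec : ∀ᶠ k in atTop, X ≤ (E.messages k i).filterMap Msg.report?)
    (hready : ∀ M ∈ X, ∀ᶠ k in atTop, reportReady S (E.state k i) M) :
    ∀ᶠ k in atTop, X.map ReportMsg.recVals ≤ (E.state k i).reports s := by
  obtain ⟨K, hK⟩ := eventually_atTop.1 (hrec.and (eventually_forall_mem hready))
  obtain ⟨k1, h1, h2⟩ := hi.report_visits hn hE hs K
  obtain ⟨h3, h4⟩ := hK k1 h1
  obtain ⟨a, ha1, ha2, -⟩ := (E.nodeInv hn hi.nonfaulty k1).accepted_reports
  rw [ha1] at h3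
  have hle := le_of_le_add_of_disjoint h3 fun M hM hw => h2 M hw (hX M hM) (h4 M hM)
  filter_upwards [eventually_ge_atTop k1] with k hk
  refine le_trans ?_ ((E.grows hn hi.nonfaulty hk).reports s)
  rw [ha2 s]
  exact Multiset.map_le_map (Multiset.le_filter.2 ⟨hle, hX⟩)

/-- What one nonfaulty node holds, every nonfaulty node that does not terminate eventually holds. -/
theorem Runs.eventually_le (hn : 3 * S.t + 1 ≤ S.n) (hE : E.Fair) {i : Fin S.n}
    (hi : E.Runs i) (s : ℕ) {k0 : ℕ} (hs : s ≤ (E.state k0 i).r) {j : Fin S.n} (hj : j ∉ faulty)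
    (k : ℕ) :
    (∀ᶠ k' in atTop, (E.state k j).values s ≤ (E.state k' i).values s) ∧
    (∀ᶠ k' in atTop, (E.state k j).reports s ≤ (E.state k' i).reports s) := by
  induction s with
  | zero =>
    have hinv := E.nodeInv hn hj k
    have hsub := hi.eventually_received_subset hE (j := j) k
    have hv : ∀ᶠ k' in atTop, (E.state k j).values 0 ≤ (E.state k' i).values 0 := by
      filter_upwards [hsub] with k' hk'
      rw [hinv.values_zero, (E.nodeInv hn hi.nonfaulty k').values_zero]
      exact Multiset.filterMap_le_filterMap _ (E.messages_mono hk')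
    refine ⟨hv, ?_⟩
    obtain ⟨a, ha1, ha2, ha3⟩ := hinv.accepted_reports
    rw [ha2]
    refine hi.eventually_reports hn hE hs (fun M hM => (Multiset.mem_filter.1 hM).2) ?_ ?_
    · filter_upwards [hsub] with k' hk'
      refine (Multiset.filter_le _ _).trans ((Multiset.le_add_left _ _).trans (ha1.symm.le.trans ?_))
      exact Multiset.filterMap_le_filterMap _ (E.messages_mono hk')
    · intro M hM
      obtain ⟨hM, hM0⟩ := Multiset.mem_filter.1 hM
      have hr := ha3 M hM
      filter_upwards [hv] with k' hk'
      exact ⟨hM0 ▸ Nat.zero_le _, hr.2.1, hr.2.2.trans (hM0 ▸ hk')⟩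
  | succ s ih =>
    have hinv := E.nodeInv hn hj k
    have hsub := hi.eventually_received_subset hE (j := j) k
    obtain ⟨ihv, ihr⟩ := ih (by omega)
    have hround : ∀ᶠ k' in atTop, s + 1 ≤ (E.state k' i).r := by
      filter_upwards [eventually_ge_atTop k0] with k' hk'
      exact hs.trans (E.grows hn hi.nonfaulty hk').r
    -- Values must come before reports: the check of a value looks at the previous round, covered by
    -- the induction hypothesis, while the check of a report looks at the values of its own round.
    have hv : ∀ᶠ k' in atTop, (E.state k j).values (s + 1) ≤ (E.state k' i).values (s + 1) := by
      obtain ⟨a, ha1, ha2, ha3⟩ := hinv.accepted_values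
      rw [ha2 (s + 1) (by omega)]
      refine hi.eventually_values hn hE (by omega) hs
        (fun M hM => (Multiset.mem_filter.1 hM).2) ?_ ?_
      · filter_upwards [hsub] with k' hk'
        refine (Multiset.filter_le _ _).trans
          ((Multiset.le_add_left _ _).trans (ha1.symm.le.trans ?_))
        exact Multiset.filterMap_le_filterMap _ (E.messages_mono hk')
      · intro M hM
        obtain ⟨hM, hM0⟩ := Multiset.mem_filter.1 hM
        have hr := ha3 M hM
        filter_upwards [ihv, ihr, hround] with k' h1 h2 h3
        refine hr.mono (hM0 ▸ h3) (fun h => h.trans ?_) (fun h => h.trans ?_)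
        · rw [hM0]; exact h1
        · rw [hM0]; exact h2
    refine ⟨hv, ?_⟩
    obtain ⟨a, ha1, ha2, ha3⟩ := hinv.accepted_reports
    rw [ha2]
    refine hi.eventually_reports hn hE hs (fun M hM => (Multiset.mem_filter.1 hM).2) ?_ ?_
    · filter_upwards [hsub] with k' hk'
      refine (Multiset.filter_le _ _).trans ((Multiset.le_add_left _ _).trans (ha1.symm.le.trans ?_))
      exact Multiset.filterMap_le_filterMap _ (E.messages_mono hk')
    · intro M hM
      obtain ⟨hM, hM0⟩ := Multiset.mem_filter.1 hM
      have hr := ha3 M hM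
      filter_upwards [hv, hround] with k' hk' h3
      exact ⟨hM0 ▸ h3, hr.2.1, hr.2.2.trans (hM0 ▸ hk')⟩

theorem Runs.eventually_valueReady (hn : 3 * S.t + 1 ≤ S.n) (hE : E.Fair) {i : Fin S.n}
    (hi : E.Runs i) {j : Fin S.n} (hj : j ∉ faulty) {k k0 : ℕ} {M : ValueMsg m}
    (hM : valueReady S (E.state k j) M) (hs : M.round ≤ (E.state k0 i).r) :
    ∀ᶠ k' in atTop, valueReady S (E.state k' i) M := by
  obtain ⟨h1, h2⟩ := hi.eventually_le hn hE (M.round - 1) (k0 := k0) (by omega) hj k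
  filter_upwards [h1, h2, eventually_ge_atTop k0] with k' h1 h2 h3
  exact hM.mono (hs.trans (E.grows hn hi.nonfaulty h3).r) (fun h => h.trans h1)
    (fun h => h.trans h2)

theorem Runs.eventually_reportReady (hn : 3 * S.t + 1 ≤ S.n) (hE : E.Fair) {i : Fin S.n}
    (hi : E.Runs i) {j : Fin S.n} (hj : j ∉ faulty) {k k0 : ℕ} {M : ReportMsg m}
    (hM : reportReady S (E.state k j) M) (hs : M.round ≤ (E.state k0 i).r) :
    ∀ᶠ k' in atTop, reportReady S (E.state k' i) M := by
  obtain ⟨h1, -⟩ := hi.eventually_le hn hE M.round hs hj k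
  filter_upwards [h1, eventually_ge_atTop k0] with k' h1 h3
  exact ⟨hs.trans (E.grows hn hi.nonfaulty h3).r, hM.2.1, hM.2.2.trans h1⟩

/-! ### Progress through all rounds and termination. -/

/-- A node that does not terminate stays behind the nodes that do. -/
theorem Runs.round_lt (hn : 3 * S.t + 1 ≤ S.n) (hE : E.Fair) {i : Fin S.n}
    (hi : E.Runs i) {j : Fin S.n} (hj : j ∉ faulty) {k : ℕ}
    (hk : (E.state k j).phase = .terminated) (k' : ℕ) : (E.state k' i).r < (E.state k j).r := by
  by_contra! hle
  have hinv := E.nodeInv hn hj k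
  obtain ⟨hr1, ht⟩ := hinv.main_round (by rw [hk]; trivial)
  have hh := hinv.terminated hk
  rw [hinv.halt ht, nextSmallest_le_iff _ _ (EReal.coe_ne_top _)] at hh
  obtain ⟨K, hK⟩ := eventually_atTop.1 (hi.eventually_received_subset hE (j := j) k)
  obtain ⟨k1, h1, h2⟩ := (hi.main_visits hn hE (k := max K k')
    (hr1.trans (hle.trans (E.grows hn hi.nonfaulty (le_max_right K k')).r))).1
  have hinv1 := E.nodeInv hn hi.nonfaulty k1
  have hsub := hK k1 (le_trans (le_max_left _ _) h1)
  have htimes : (E.state k j).terminationTimes ≤ (E.state k1 i).terminationTimes := by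
    rw [hinv.times, hinv1.times]
    exact Multiset.filterMap_le_filterMap _ (E.messages_mono hsub)
  -- Further estimates can only lower the `(t+1)`-th smallest one, so `i` would have to stop no
  -- later than in the round where `j` did.
  have hhalt : (E.state k1 i).halt ≤ (((E.state k j).r : ℝ) : EReal) := by
    rw [hinv1.halt (ht.trans (Multiset.card_le_card htimes)),
      nextSmallest_le_iff _ _ (EReal.coe_ne_top _)]
    exact hh.trans_le (Multiset.card_le_card (Multiset.filter_le_filter _ htimes))
  have hlt := h2.trans_le hhalt
  rw [EReal.coe_lt_coe_iff, Nat.cast_lt] at hlt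
  have := (E.grows hn hi.nonfaulty (le_trans (le_max_right K k') h1)).r
  omega

theorem runs_or_terminates (E : Execution S faulty input) {j : Fin S.n} (hj : j ∉ faulty) :
    E.Runs j ∨ ∃ k, (E.state k j).phase = .terminated := by
  by_cases h : ∃ k, (E.state k j).phase = .terminated
  · exact .inr h
  · exact .inl ⟨hj, fun k hk => h ⟨k, hk⟩⟩

theorem full_of_terminated (E : Execution S faulty input) (hn : 3 * S.t + 1 ≤ S.n) {j : Fin S.n}
    (hj : j ∉ faulty) {k : ℕ} (hk : (E.state k j).phase = .terminated) :
    S.n - S.t ≤ ((E.state k j).reports 0).card ∧ S.n - S.t ≤ ((E.state k j).values 0).card := by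
  have hinv := E.nodeInv hn hj k
  have h := hinv.full_reports 0 (hinv.main_round (by rw [hk]; trivial)).1
  exact ⟨h, hinv.full_values (by omega) h⟩

theorem exists_input_sent (hn : 3 * S.t + 1 ≤ S.n) (hE : E.Fair) {j : Fin S.n}
    (hj : j ∉ faulty) : ∃ k, Msg.initValue (input j) ∈ (E.state k j).sent := by
  have key : ∃ k, (E.state k j).phase ≠ .start := by
    rcases E.runs_or_terminates hj with h | ⟨k, hk⟩
    · obtain ⟨k, -, hk⟩ := h.start_exit hn hE (k := 0) (by rw [E.initially j hj]; rfl)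
      exact ⟨k, by simp [hk]⟩
    · exact ⟨k, by simp [hk]⟩
  exact key.imp fun k hk => (E.nodeInv hn hj k).input_sent hk

/-- This is where validity of the nonfaulty inputs enters: receivers drop invalid ones, and `n - t`
accepted inputs are needed to start. -/
theorem Runs.full_values_zero (hn : 3 * S.t + 1 ≤ S.n) (hfaulty : faulty.card ≤ S.t)
    (hE : E.Fair) (hin : ∀ j, j ∉ faulty → input j ∈ S.validInputs) {i : Fin S.n}
    (hi : E.Runs i) : ∃ k, S.n - S.t ≤ ((E.state k i).values 0).card := by
  have h := hi.eventually_map_le hE (Msg.validInput? S) input (fun j hj => by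
    obtain ⟨k, hk⟩ := exists_input_sent hn hE hj
    have hv : S.exVal (input j) = true := hin j hj
    exact ⟨k, _, by simp [Msg.validInput?, hv], hk⟩)
  obtain ⟨k, hk⟩ := h.exists
  refine ⟨k, ?_⟩
  rw [(E.nodeInv hn hi.nonfaulty k).values_zero]
  exact (le_card_map_compl hfaulty _).trans (Multiset.card_le_card hk)

/-- If all nonfaulty nodes report in round `s`, then a node in round `s` gets enough reports. -/
theorem Runs.full_reports_of_sent (hn : 3 * S.t + 1 ≤ S.n) (hfaulty : faulty.card ≤ S.t)
    (hE : E.Fair) {i : Fin S.n} (hi : E.Runs i) {s k0 : ℕ} (hs : s ≤ (E.state k0 i).r)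
    (h : ∀ j, j ∉ faulty → ∃ k, S.n - S.t ≤ ((E.state k j).values s).card) :
    ∀ᶠ k in atTop, S.n - S.t ≤ ((E.state k i).reports s).card := by
  have h' : ∀ j, ∃ M : ReportMsg m, j ∉ faulty →
      ∃ k, Msg.report M ∈ (E.state k j).sent ∧ M.round = s := by
    intro j
    by_cases hj : j ∈ faulty
    · exact ⟨⟨0, 0⟩, fun h => (h hj).elim⟩
    · obtain ⟨k, hk⟩ := h j hj
      obtain ⟨M, hM⟩ := (E.nodeInv hn hj k).report_sent s hk
      exact ⟨M, fun _ => ⟨k, hM⟩⟩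
  choose g hg using h'
  have hev := hi.eventually_reports hn hE hs (X := (faultyᶜ).val.map g) ?_
    (hi.eventually_map_le hE Msg.report? g fun j hj =>
      (hg j hj).imp fun k hk => ⟨_, rfl, hk.1⟩) ?_
  · filter_upwards [hev] with k hk
    rw [Multiset.map_map] at hk
    exact (le_card_map_compl hfaulty _).trans (Multiset.card_le_card hk)
  · intro M hM
    obtain ⟨j, hj, rfl⟩ := Multiset.mem_map.1 hM
    obtain ⟨k, -, h2⟩ := hg j (Finset.mem_compl.1 hj)
    exact h2
  · intro M hM
    obtain ⟨j, hj, rfl⟩ := Multiset.mem_map.1 hM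
    have hj := Finset.mem_compl.1 hj
    obtain ⟨k, h1, h2⟩ := hg j hj
    exact hi.eventually_reportReady hn hE hj ((E.nodeInv hn hj k).sent_report _ h1)
      (h2.symm ▸ hs)

/-- If all nonfaulty nodes reach round `s`, then a node in round `s` gets enough values. -/
theorem Runs.full_values_of_round (hn : 3 * S.t + 1 ≤ S.n) (hfaulty : faulty.card ≤ S.t)
    (hE : E.Fair) {i : Fin S.n} (hi : E.Runs i) {s k0 : ℕ} (hs1 : 1 ≤ s)
    (hs : s ≤ (E.state k0 i).r) (h : ∀ j, j ∉ faulty → ∃ k, s ≤ (E.state k j).r) :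
    ∃ k, S.n - S.t ≤ ((E.state k i).values s).card := by
  have h' : ∀ j, ∃ M : ValueMsg m, j ∉ faulty →
      ∃ k, Msg.value M ∈ (E.state k j).sent ∧ M.round = s := by
    intro j
    by_cases hj : j ∈ faulty
    · exact ⟨⟨0, 0, 0, 0⟩, fun h => (h hj).elim⟩
    · obtain ⟨k, hk⟩ := h j hj
      obtain ⟨M, hM⟩ := (E.nodeInv hn hj k).value_sent s hs1 hk
      exact ⟨M, fun _ => ⟨k, hM⟩⟩
  choose g hg using h'
  have hev := hi.eventually_values hn hE hs1 hs (X := (faultyᶜ).val.map g) ?_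
    (hi.eventually_map_le hE Msg.value? g fun j hj =>
      (hg j hj).imp fun k hk => ⟨_, rfl, hk.1⟩) ?_
  · obtain ⟨k, hk⟩ := hev.exists
    rw [Multiset.map_map] at hk
    exact ⟨k, (le_card_map_compl hfaulty _).trans (Multiset.card_le_card hk)⟩
  · intro M hM
    obtain ⟨j, hj, rfl⟩ := Multiset.mem_map.1 hM
    obtain ⟨k, -, h2⟩ := hg j (Finset.mem_compl.1 hj)
    exact h2
  · intro M hM
    obtain ⟨j, hj, rfl⟩ := Multiset.mem_map.1 hM
    have hj := Finset.mem_compl.1 hj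
    obtain ⟨k, h1, h2⟩ := hg j hj
    exact hi.eventually_valueReady hn hE hj ((E.nodeInv hn hj k).sent_value _ h1)
      (h2.symm ▸ hs)

theorem Runs.eventually_full_reports_zero (hn : 3 * S.t + 1 ≤ S.n) (hfaulty : faulty.card ≤ S.t)
    (hE : E.Fair) (hin : ∀ j, j ∉ faulty → input j ∈ S.validInputs) {i : Fin S.n}
    (hi : E.Runs i) : ∀ᶠ k in atTop, S.n - S.t ≤ ((E.state k i).reports 0).card := by
  refine hi.full_reports_of_sent hn hfaulty hE (k0 := 0) (Nat.zero_le _) fun j hj => ?_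
  rcases E.runs_or_terminates hj with h | ⟨k, hk⟩
  · exact h.full_values_zero hn hfaulty hE hin
  · exact ⟨k, (E.full_of_terminated hn hj hk).2⟩

/-- The estimates of all nonfaulty nodes are eventually received, and they are not `∞`. -/
theorem Runs.eventually_times (hn : 3 * S.t + 1 ≤ S.n) (hfaulty : faulty.card ≤ S.t)
    (hE : E.Fair) (hin : ∀ j, j ∉ faulty → input j ∈ S.validInputs) {i : Fin S.n}
    (hi : E.Runs i) : ∃ e : Fin S.n → EReal, (∀ j, e j ≠ ⊤) ∧
      ∀ᶠ k in atTop, (faultyᶜ).val.map e ≤ (E.state k i).terminationTimes := by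
  have h : ∀ j, ∃ e : EReal, e ≠ ⊤ ∧ (j ∉ faulty → ∃ k, Msg.enough e ∈ (E.state k j).sent) := by
    intro j
    by_cases hj : j ∈ faulty
    · exact ⟨⊥, by simp, fun h => (h hj).elim⟩
    · have : ∃ k, S.n - S.t ≤ ((E.state k j).reports 0).card := by
        rcases E.runs_or_terminates hj with h | ⟨k, hk⟩
        · exact (h.eventually_full_reports_zero hn hfaulty hE hin).exists
        · exact ⟨k, (E.full_of_terminated hn hj hk).1⟩
      obtain ⟨k, hk⟩ := this
      obtain ⟨e, he⟩ := (E.nodeInv hn hj k).estimate_sent hk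
      obtain ⟨A, rfl, -⟩ := (E.nodeInv hn hj k).sent_enough e he
      refine ⟨_, ?_, fun _ => ⟨k, he⟩⟩
      unfold enoughRounds
      split_ifs
      · simp
      · exact EReal.coe_ne_top _
  choose e he using h
  refine ⟨e, fun j => (he j).1, ?_⟩
  filter_upwards [hi.eventually_map_le hE Msg.estimate? e fun j hj =>
    ((he j).2 hj).imp fun k hk => ⟨_, rfl, hk⟩] with k hk
  rw [(E.nodeInv hn hi.nonfaulty k).times]
  exact hk

/-- Once enough estimates and round `0` reports are held, the test of the initialization loop can no
longer succeed. -/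
theorem Runs.exists_one_le_round (hn : 3 * S.t + 1 ≤ S.n) (hfaulty : faulty.card ≤ S.t)
    (hE : E.Fair) (hin : ∀ j, j ∉ faulty → input j ∈ S.validInputs) {i : Fin S.n}
    (hi : E.Runs i) : ∃ k, 1 ≤ (E.state k i).r := by
  obtain ⟨e, -, he⟩ := hi.eventually_times hn hfaulty hE hin
  obtain ⟨K, hK⟩ := eventually_atTop.1
    (he.and (hi.eventually_full_reports_zero hn hfaulty hE hin))
  obtain ⟨k, -, h | ⟨-, k', hk', h⟩⟩ := hi.exists_initLoop hn hE K
  · exact ⟨k, h⟩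
  · obtain ⟨h1, h2⟩ := hK k' hk'
    have h3 := (le_card_map_compl hfaulty e).trans (Multiset.card_le_card h1)
    omega

/-- The induction runs over all running nodes at once, since one node advances only with the
messages of the others. Terminated nodes are no obstacle: by `Runs.round_lt` they have completed
round `s`. -/
theorem Runs.exists_le_round (hn : 3 * S.t + 1 ≤ S.n) (hfaulty : faulty.card ≤ S.t)
    (hE : E.Fair) (hin : ∀ j, j ∉ faulty → input j ∈ S.validInputs) (s : ℕ) {i : Fin S.n}
    (hi : E.Runs i) : ∃ k, s ≤ (E.state k i).r := by
  induction s generalizing i with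
  | zero => exact ⟨0, Nat.zero_le _⟩
  | succ s ih =>
    rcases Nat.eq_zero_or_pos s with rfl | hs1
    · exact hi.exists_one_le_round hn hfaulty hE hin
    by_contra! hcon
    have hterm : ∀ j, j ∉ faulty → ∀ k, (E.state k j).phase = .terminated →
        s < (E.state k j).r := by
      intro j hj k hk
      obtain ⟨k', hk'⟩ := ih hi
      exact hk'.trans_lt (hi.round_lt hn hE hj hk k')
    have hall : ∀ j, j ∉ faulty → ∃ k, s ≤ (E.state k j).r := by
      intro j hj
      rcases E.runs_or_terminates hj with h | ⟨k, hk⟩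
      · exact ih h
      · exact ⟨k, (hterm j hj k hk).le⟩
    have hfull : ∀ j, j ∉ faulty → ∃ k, S.n - S.t ≤ ((E.state k j).values s).card := by
      intro j hj
      rcases E.runs_or_terminates hj with h | ⟨k, hk⟩
      · obtain ⟨k0, hk0⟩ := ih h
        exact h.full_values_of_round hn hfaulty hE hs1 hk0 hall
      · have hinv := E.nodeInv hn hj k
        exact ⟨k, hinv.full_values (by omega) (hinv.full_reports s (hterm j hj k hk))⟩
    obtain ⟨k0, hk0⟩ := ih hi
    obtain ⟨K, hK⟩ := eventually_atTop.1 (hi.full_reports_of_sent hn hfaulty hE hk0 hfull)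
    have h1 := hK (max K k0) (le_max_left _ _)
    have h2 := hk0.trans (E.grows hn hi.nonfaulty (le_max_right K k0)).r
    have h3 : (E.state (max K k0) i).r = s := le_antisymm (Nat.lt_succ_iff.1 (hcon _)) h2
    -- A node stuck in round `s` would hold `n - t` reports of its current round, yet the last of
    -- them would have advanced it.
    have h4 := (E.nodeInv hn hi.nonfaulty (max K k0)).current_reports (by omega)
    rw [h3] at h4
    omega

theorem not_runs (hn : 3 * S.t + 1 ≤ S.n) (hfaulty : faulty.card ≤ S.t)
    (hE : E.Fair) (hin : ∀ j, j ∉ faulty → input j ∈ S.validInputs) (i : Fin S.n) :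
    ¬ E.Runs i := by
  intro hi
  obtain ⟨e, hetop, he⟩ := hi.eventually_times hn hfaulty hE hin
  have hB : ∀ j, ∃ B : ℕ, e j ≤ ((B : ℝ) : EReal) := by
    intro j
    obtain ⟨x, hx⟩ : ∃ x : ℝ, e j ≤ x := by
      rcases EReal.lt_iff_exists_real_btwn.1 (lt_top_iff_ne_top.2 (hetop j)) with ⟨x, hx, -⟩
      exact ⟨x, hx.le⟩
    obtain ⟨B, hB⟩ := exists_nat_ge x
    exact ⟨B, hx.trans (EReal.coe_le_coe_iff.2 hB)⟩
  choose b hb using hB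
  -- The sum dominates every `b j`; the extra `1` ensures that a node in round `B` is in the main
  -- loop.
  set B := (∑ j, b j) + 1 with hBdef
  have hbB : ∀ j, e j ≤ ((B : ℝ) : EReal) := fun j => (hb j).trans (by
    rw [EReal.coe_le_coe_iff, Nat.cast_le]
    exact (Finset.single_le_sum (fun _ _ => Nat.zero_le _) (Finset.mem_univ j)).trans
      (Nat.le_succ _))
  obtain ⟨K, hK⟩ := eventually_atTop.1 he
  obtain ⟨k0, hk0⟩ := hi.exists_le_round hn hfaulty hE hin B
  obtain ⟨k, h1, h2⟩ := (hi.main_visits hn hE (k := max K k0)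
    (le_trans (by omega) (hk0.trans (E.grows hn hi.nonfaulty (le_max_right K k0)).r))).1
  have h3 := hK k (le_trans (le_max_left _ _) h1)
  have h4 := hk0.trans (E.grows hn hi.nonfaulty (le_trans (le_max_right K k0) h1)).r
  have h5 := le_card_map_compl hfaulty e
  have hhalt : (E.state k i).halt ≤ ((B : ℝ) : EReal) := by
    rw [(E.nodeInv hn hi.nonfaulty k).halt (h5.trans (Multiset.card_le_card h3)),
      nextSmallest_le_iff _ _ (EReal.coe_ne_top _)]
    -- The estimates of the nonfaulty nodes alone number at least `n - t > t` and are all at most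
    -- `B`, whatever the faulty nodes send.
    refine lt_of_lt_of_le (lt_of_lt_of_le (by omega) h5) (Multiset.card_le_card
      (Multiset.le_filter.2 ⟨h3, fun x hx => ?_⟩))
    obtain ⟨j, -, rfl⟩ := Multiset.mem_map.1 hx
    exact hbB j
  have hlt := h2.trans_le hhalt
  rw [EReal.coe_lt_coe_iff, Nat.cast_lt] at hlt
  omega

end Execution

end ApproxAgreement

open ApproxAgreement in
theorem mainTheorem2 {m : ℕ} (S : Setup m) (hn : 3 * S.t + 1 ≤ S.n) (hε : 0 < S.ε)
    (hfar : IsFurthestRule S.furthest)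
    (faulty : Finset (Fin S.n)) (hfaulty : faulty.card ≤ S.t)
    (input : Fin S.n → Point m) (E : Execution S faulty input)
    (i : Fin S.n) (hi : i ∉ faulty) :
    (E.Fair → (∀ j, j ∉ faulty → input j ∈ S.validInputs) →
      ∃ k, (E.state k i).phase = Phase.terminated) ∧
    (Bornology.IsBounded S.validInputs → ∀ k,
      ((E.state k i).r : ℤ) ≤ roundBound (Metric.diam S.validInputs) S.ε) ∧
    (Bornology.IsBounded S.validInputs → 2 * S.ε ≤ Metric.diam S.validInputs → ∀ k,
      ((E.state k i).r : ℝ) ≤ 5 * Real.logb 2 (Metric.diam S.validInputs / S.ε)) := by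
  refine ⟨fun hE hin => ?_, fun hV k => E.round_le hn hε hfaulty hi hV k, fun hV hD k => ?_⟩
  · exact (E.runs_or_terminates hi).resolve_left (Execution.not_runs hn hfaulty hE hin i)
  · refine le_trans ?_ (roundBound_le_log hε hD)
    exact_mod_cast E.round_le hn hε hfaulty hi hV k
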